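/- Conventions. A tracial von Neumann algebra $(M,\tau)$ is a von Neumann algebra $M$ with a faithful normal tracial state $\tau$; $\|x\|_2=\tau(x^*x)^{1/2}$. Inclusions of von Neumann algebras are unital unless said otherwise: $P\subseteq zMz$ has unit $z$, and $P_0\subseteq rNr$ has unit $r$. For a von Neumann subalgebra $B\subseteq A$ (where $A$ is $M$ or a corner of $M$ or of a subalgebra of $M$), $E_B$ is the $\tau$-preserving conditional expectation onto $B$, $B'\cap A$ is the relative commutant, $B\vee C$ is the von Neumann algebra generated by $B\cup C$, and the (Pimsner–Popa) index is $[A:B]=\lambda^{-1}$ with $\lambda=\inf\{\|E_B(x)\|_2^2/\|x\|_2^2 : 0\neq x\in A_+\}$ and $1/0=\infty$. For von Neumann subalgebras $P,Q$ of $M$, not necessarily unital, $P\preceq_M Q$ means that there are non-zero projections $p\in P$, $q\in Q$, a $*$-homomorphism $\theta:pPp\to qQq$ and a non-zero partial isometry $v\in qMp$ such that $\theta(x)v=vx$ for all $x\in pPp$. Proposition. Let $(M,\tau)$ be a tracial von Neumann algebra and let $z\in M$ be a non-zero projection. Let $P\subseteq zMz$ and $N\subseteq M$ be von Neumann subalgebras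 such that $P\vee(P'\cap zMz)\subseteq zMz$ has finite index and such that $P\preceq_M N$. Then there are a scalar $s>0$, non-zero projections $r\in N$ and $p\in P$, a von Neumann subalgebra $P_0\subseteq rNr$ and a $*$-isomorphism $\theta:pPp\to P_0$ such that: 1. $P_0\vee(P_0'\cap rNr)\subseteq rNr$ has finite index; 2. there is a non-zero partial isometry $v\in M$ such that $rE_N(vv^*)=E_N(vv^*)r\ge sr$ and $\theta(x)v=rvx$ for all $x\in pPp$; in particular $\theta(pPp)v=P_0v=rv\,pPp$; 3. for this $v$, the von Neumann algebra generated by $E_N\big(v(pP'p\cap pMp)v^*\big)$ is contained in $P_0'\cap rNr$. -/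

import Mathlib

open scoped ComplexOrder ENNReal

/-- A von Neumann algebra of operators on `H` whose unit is a projection of `B(H)`, not
necessarily the identity operator: a `*`-subalgebra `A` of `B(H)` with a unit `e` that equals
its bicommutant, the bicommutant being taken in `e B(H) e`, that is, `A = A'' ∩ e B(H) e`. -/
structure VNSubalgebra (H : Type*) [NormedAddCommGroup H] [InnerProductSpace ℂ H]
    [CompleteSpace H] extends NonUnitalStarSubalgebra ℂ (H →L[ℂ] H) where
  /-- The unit of the algebra. -/
  unit : H →L[ℂ] H
  unit_mem : unit ∈ carrier
  unit_mul : ∀ x ∈ carrier, unit * x = x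
  mul_unit : ∀ x ∈ carrier, x * unit = x
  bicommutant : ∀ x ∈ Set.centralizer (Set.centralizer carrier),
    unit * x = x → x * unit = x → x ∈ carrier

namespace VNSubalgebra

variable {H : Type*} [NormedAddCommGroup H] [InnerProductSpace ℂ H] [CompleteSpace H]

/-- The underlying set of operators. -/
def toSet (A : VNSubalgebra H) : Set (H →L[ℂ] H) := A.carrier

/-- A von Neumann algebra containing the identity operator, as an algebra with unit `1`. -/
def ofVonNeumannAlgebra (M : VonNeumannAlgebra H) : VNSubalgebra H where
  carrier := (M : Set (H →L[ℂ] H))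
  add_mem' := fun ha hb => M.toStarSubalgebra.add_mem ha hb
  zero_mem' := M.toStarSubalgebra.zero_mem
  mul_mem' := fun ha hb => M.toStarSubalgebra.mul_mem ha hb
  smul_mem' := fun c _ hx => M.toStarSubalgebra.smul_mem hx c
  star_mem' := fun ha => M.star_mem' ha
  unit := 1
  unit_mem := M.toStarSubalgebra.one_mem
  unit_mul := fun x _ => one_mul x
  mul_unit := fun x _ => mul_one x
  bicommutant := fun x hx _ _ => by
    have h : x ∈ Set.centralizer (Set.centralizer (M : Set (H →L[ℂ] H))) := hx
    rwa [M.centralizer_centralizer] at h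

/-- The corner `p A p` of `A` at a projection `p ∈ A`; its elements are the `x ∈ A` with
`p x = x = x p`, and its unit is `p`. -/
def corner (A : VNSubalgebra H) (p : H →L[ℂ] H) (hp : IsStarProjection p) (hpA : p ∈ A.toSet) :
    VNSubalgebra H where
  carrier := {x | x ∈ A.carrier ∧ p * x = x ∧ x * p = x}
  add_mem' := fun {a b} ha hb =>
    ⟨A.add_mem' ha.1 hb.1, by rw [mul_add, ha.2.1, hb.2.1], by rw [add_mul, ha.2.2, hb.2.2]⟩
  zero_mem' := ⟨A.zero_mem', mul_zero _, zero_mul _⟩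
  mul_mem' := fun {a b} ha hb =>
    ⟨A.mul_mem' ha.1 hb.1, by rw [← mul_assoc, ha.2.1], by rw [mul_assoc, hb.2.2]⟩
  smul_mem' := fun c x hx =>
    ⟨A.smul_mem' c hx.1, by rw [mul_smul_comm, hx.2.1], by rw [smul_mul_assoc, hx.2.2]⟩
  star_mem' := fun {a} ha => by
    refine ⟨A.star_mem' ha.1, ?_, ?_⟩
    · have h := congrArg star ha.2.2
      rwa [star_mul, hp.isSelfAdjoint.star_eq] at h
    · have h := congrArg star ha.2.1
      rwa [star_mul, hp.isSelfAdjoint.star_eq] at h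
  unit := p
  unit_mem := ⟨hpA, hp.isIdempotentElem, hp.isIdempotentElem⟩
  unit_mul := fun _ hx => hx.2.1
  mul_unit := fun _ hx => hx.2.2
  bicommutant := fun x hx h1 h2 => by
    have hpe : A.unit * p = p := A.unit_mul p hpA
    have hep : p * A.unit = p := A.mul_unit p hpA
    refine ⟨A.bicommutant x ?_ ?_ ?_, h1, h2⟩
    · exact Set.centralizer_subset (Set.centralizer_subset fun y hy => hy.1) hx
    · rw [← h1, ← mul_assoc, hpe]
    · rw [← h2, mul_assoc, hep]

end VNSubalgebra

section

variable {H : Type*} [NormedAddCommGroup H] [InnerProductSpace ℂ H] [CompleteSpace H]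

/-- The von Neumann algebra generated by a set `S` of operators: the intersection of all von
Neumann algebras (with arbitrary unit) containing `S`. For von Neumann algebras `B`, `C` with a
common unit, `vnGenerated (B ∪ C)` is `B ∨ C`. -/
def vnGenerated (S : Set (H →L[ℂ] H)) : Set (H →L[ℂ] H) :=
  {x | ∀ A : VNSubalgebra H, S ⊆ A.toSet → x ∈ A.toSet}

/-- The relative commutant `B' ∩ A`. -/
def relCommutant (B A : Set (H →L[ℂ] H)) : Set (H →L[ℂ] H) :=
  Set.centralizer B ∩ A

/-- `v` is a partial isometry. -/
def IsPartialIsometry (v : H →L[ℂ] H) : Prop := v * star v * v = v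

/-- `τ` is a faithful normal tracial state on `M`. Normality is `σ`-weak continuity: `τ` is
`x ↦ ∑ₙ ⟪ξₙ, x ηₙ⟫` for square-summable sequences of vectors `ξ`, `η`. -/
structure IsFaithfulNormalTracialState (M : VonNeumannAlgebra H)
    (τ : M.toStarSubalgebra →ₗ[ℂ] ℂ) : Prop where
  map_one : τ 1 = 1
  nonneg : ∀ x, 0 ≤ τ (star x * x)
  faithful : ∀ x, τ (star x * x) = 0 → x = 0
  trace : ∀ x y, τ (x * y) = τ (y * x)
  normal : ∃ ξ η : ℕ → H, Summable (fun n => ‖ξ n‖ ^ 2) ∧ Summable (fun n => ‖η n‖ ^ 2) ∧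
    ∀ x : M.toStarSubalgebra,
      HasSum (fun n => inner ℂ (ξ n) ((x : H →L[ℂ] H) (η n))) (τ x)

/-- The 2-norm `‖x‖₂ = τ(x* x)^{1/2}`. -/
noncomputable def traceNorm {M : VonNeumannAlgebra H} (τ : M.toStarSubalgebra →ₗ[ℂ] ℂ)
    (x : M.toStarSubalgebra) : ℝ :=
  Real.sqrt (τ (star x * x)).re

/-- `e` is the image of `x` under the trace-preserving conditional expectation onto `B`. -/
def IsCondExp {M : VonNeumannAlgebra H} (τ : M.toStarSubalgebra →ₗ[ℂ] ℂ)
    (B : Set (H →L[ℂ] H)) (x e : M.toStarSubalgebra) : Prop :=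
  (e : H →L[ℂ] H) ∈ B ∧
    ∀ y : M.toStarSubalgebra, (y : H →L[ℂ] H) ∈ B → τ (e * y) = τ (x * y)

open Classical in
/-- The `τ`-preserving conditional expectation `E_B`: the value `E_B(x)` is the element of `B`
with `τ(E_B(x) y) = τ(x y)` for all `y ∈ B`. For a faithful normal tracial state `τ` and a von
Neumann subalgebra `B` of `M` it exists and is unique; the other branch is then not used. If `B`
has unit `e`, the restriction to `e M e` is the conditional expectation `e M e → B` which
preserves the normalized trace `τ / τ(e)`. -/
noncomputable def condExp {M : VonNeumannAlgebra H} (τ : M.toStarSubalgebra →ₗ[ℂ] ℂ)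
    (B : Set (H →L[ℂ] H)) (x : M.toStarSubalgebra) : M.toStarSubalgebra :=
  if h : ∃ e, IsCondExp τ B x e then h.choose else 0

/-- The probabilistic (Pimsner-Popa) index `[A : B] = λ⁻¹` of von Neumann subalgebras `B ⊆ A` of
`M` with the same unit, where `λ = inf {‖E_B(x)‖₂² / ‖x‖₂² : x ∈ A, x ≥ 0, x ≠ 0}` and
`0⁻¹ = ∞`. Normalizing the trace of `A` does not change the quotients. -/
noncomputable def ppIndex {M : VonNeumannAlgebra H} (τ : M.toStarSubalgebra →ₗ[ℂ] ℂ)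
    (A B : Set (H →L[ℂ] H)) : ℝ≥0∞ :=
  (⨅ (x : M.toStarSubalgebra) (_ : (x : H →L[ℂ] H) ∈ A ∧ 0 ≤ (x : H →L[ℂ] H) ∧ x ≠ 0),
    ENNReal.ofReal (traceNorm τ (condExp τ B x) ^ 2 / traceNorm τ x ^ 2))⁻¹

/-- `P ≺_M Q`: a corner of `P` embeds into `Q` inside `M`. There are non-zero projections
`p ∈ P`, `q ∈ Q`, a `*`-homomorphism `θ : pPp → qQq` and a non-zero partial isometry `v ∈ qMp`
with `θ(x) v = v x` for all `x ∈ pPp`. -/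
def CornerEmbeds (M : VonNeumannAlgebra H) (P Q : VNSubalgebra H) : Prop :=
  ∃ (p : H →L[ℂ] H) (hp : IsStarProjection p) (hpP : p ∈ P.toSet)
    (q : H →L[ℂ] H) (hq : IsStarProjection q) (hqQ : q ∈ Q.toSet)
    (θ : (P.corner p hp hpP).toNonUnitalStarSubalgebra →⋆ₙₐ[ℂ]
      (Q.corner q hq hqQ).toNonUnitalStarSubalgebra)
    (v : H →L[ℂ] H),
    p ≠ 0 ∧ q ≠ 0 ∧ v ∈ M ∧ v ≠ 0 ∧ IsPartialIsometry v ∧ q * v = v ∧ v * p = v ∧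
      ∀ x, (θ x : H →L[ℂ] H) * v = v * (x : H →L[ℂ] H)

end

/-! The partial isometry of the given embedding is improved until `N` sees its whole range. With E =
E_N(vv*), bimodularity of E_N shows that E commutes with θ(pPp), hence so does a spectral projection
r ≠ 0 of E with Er ≥ sr. Let w be the polar part of T = rv. It still intertwines, and T is a
contraction, so TT* ≤ ww* and E_N(ww*) ≥ E_N(TT*) = Er ≥ sr. Consequently an X in N with Xw = 0
satisfies Xr = 0. Cut p down to the smallest projection c of pPp above w*w. Then t(x) = θ(x)r on cPc
has t(c) = r, is injective and respects bounded weak limits, so P₀ = t(cPc) is a von Neumann algebra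
(`CornerEmbeds.exists_intertwiner`, `eq_of_weakLim_of_intertwines`, `exists_vnSubalgebra_eq_range`).
The v of the conclusion is w.

The index is controlled by the compression x ↦ w*xw from rNr to zMz. Put Q = P ∨ (P' ∩ zMz) and B =
P₀ ∨ (P₀' ∩ rNr). On positive x it is bounded below, ‖w*xw‖₂ ≥ s‖x‖₂, by Cauchy–Schwarz and E_N(ww*)
≥ sr (`IsTraceOn.sqNormTwo_conjugate_ge`). It also sends elements of rNr orthogonal to B to elements
orthogonal to Q: for a in P, b in P' ∩ zMz and d in rNr, τ(ab·w*dw) = τ(t(cac) E_N(wbw*) d), and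
E_N(wbw*) lies in P₀' ∩ rNr (`map_mul_conjugate_eq_zero`). Hence E_Q(w*xw) = E_Q(w* E_B(x) w), which
gives ‖E_Q(w*xw)‖₂ ≤ ‖E_B(x)‖₂. Together these yield [rNr : B] ≤ s⁻² [zMz : Q].

Conditional expectations are built as nearest points for the 2-norm in the weakly compact positive
unit ball (`IsTraceOn.exists_condExp_of_clamp`). -/

/-! ### Weak operator limits of bounded sequences along an ultrafilter. -/

section WeakLimits

open Filter Topology

variable {H : Type*} [NormedAddCommGroup H] [InnerProductSpace ℂ H]

/-- Convergence in the weak operator topology along a filter on `ℕ`. -/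
def WeakLim (U : Filter ℕ) (y : ℕ → H →L[ℂ] H) (a : H →L[ℂ] H) : Prop :=
  ∀ ξ η : H, Tendsto (fun n => inner ℂ ξ (y n η)) U (𝓝 (inner ℂ ξ (a η)))

variable {U : Filter ℕ} {y y' : ℕ → H →L[ℂ] H} {a a' : H →L[ℂ] H}

theorem WeakLim.unique [U.NeBot] (h : WeakLim U y a) (h' : WeakLim U y a') : a = a' := by
  ext η
  refine ext_inner_left ℂ fun ξ => ?_
  exact tendsto_nhds_unique (h ξ η) (h' ξ η)

theorem WeakLim.const (a : H →L[ℂ] H) : WeakLim U (fun _ => a) a :=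
  fun _ _ => tendsto_const_nhds

theorem WeakLim.of_tendsto (h : Tendsto y U (𝓝 a)) : WeakLim U y a := fun ξ η => by
  have h1 : Tendsto (fun n => y n η) U (𝓝 (a η)) :=
    ((ContinuousLinearMap.apply ℂ H η).continuous.tendsto a).comp h
  exact tendsto_const_nhds.inner h1

theorem WeakLim.sub (h : WeakLim U y a) (h' : WeakLim U y' a') :
    WeakLim U (fun n => y n - y' n) (a - a') := fun ξ η => by
  simpa [inner_sub_right] using (h ξ η).sub (h' ξ η)

theorem WeakLim.mul_right (h : WeakLim U y a) (b : H →L[ℂ] H) :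
    WeakLim U (fun n => y n * b) (a * b) := fun ξ η => h ξ (b η)

theorem WeakLim.mul_left [CompleteSpace H] (h : WeakLim U y a) (b : H →L[ℂ] H) :
    WeakLim U (fun n => b * y n) (b * a) := fun ξ η => by
  simpa [ContinuousLinearMap.adjoint_inner_left] using h (ContinuousLinearMap.adjoint b ξ) η

/-- The order of ℂ makes `0 ≤` include vanishing of the imaginary part, and over ℂ a real quadratic
form already forces symmetry. -/
theorem clm_nonneg_iff_inner {T : H →L[ℂ] H} : 0 ≤ T ↔ ∀ x : H, 0 ≤ inner ℂ x (T x) := by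
  rw [ContinuousLinearMap.nonneg_iff_isPositive]
  refine ⟨fun h x => h.inner_nonneg_right x, fun h => ?_⟩
  rw [ContinuousLinearMap.isPositive_iff_complex]
  intro x
  obtain ⟨h1, h2⟩ := RCLike.nonneg_iff.1 (h x)
  have h3 : (inner ℂ (T x) x : ℂ) = ((RCLike.re (inner ℂ x (T x)) : ℝ) : ℂ) := by
    rw [← inner_conj_symm]
    exact Complex.ext (by rw [Complex.conj_re]; rfl)
      (by rw [Complex.conj_im]; simpa using h2)
  rw [h3]
  exact ⟨by simp, by simpa using h1⟩

theorem WeakLim.nonneg [U.NeBot] (h : WeakLim U y a) (hy : ∀ n, 0 ≤ y n) : 0 ≤ a :=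
  clm_nonneg_iff_inner.2 fun x =>
    ge_of_tendsto' (h x x) fun n => clm_nonneg_iff_inner.1 (hy n) x

/-- Each matrix coefficient stays in a compact disc, so it converges along the ultrafilter. The
limits form a bounded sesquilinear form, which the Riesz theorem represents by an operator. -/
theorem exists_weakLim [CompleteSpace H] (U : Ultrafilter ℕ) (y : ℕ → H →L[ℂ] H) (K : ℝ)
    (hy : ∀ n, ‖y n‖ ≤ K) : ∃ a : H →L[ℂ] H, WeakLim U y a := by
  have hK : 0 ≤ K := (norm_nonneg _).trans (hy 0)
  have hb : ∀ ξ η n, ‖(inner ℂ (y n ξ) η : ℂ)‖ ≤ K * ‖ξ‖ * ‖η‖ := fun ξ η n =>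
    (norm_inner_le_norm _ _).trans
      (mul_le_mul_of_nonneg_right ((y n).le_of_opNorm_le (hy n) ξ) (norm_nonneg _))
  have hex : ∀ ξ η : H, ∃ l : ℂ, Tendsto (fun n => (inner ℂ (y n ξ) η : ℂ)) U (𝓝 l) := by
    intro ξ η
    have hc : IsCompact (Metric.closedBall (0 : ℂ) (K * ‖ξ‖ * ‖η‖)) := isCompact_closedBall _ _
    obtain ⟨l, -, hl⟩ := hc.ultrafilter_le_nhds (U.map fun n => (inner ℂ (y n ξ) η : ℂ))
      (by
        rw [le_principal_iff, Ultrafilter.coe_map, mem_map]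
        exact Filter.univ_mem' fun n => by simpa using hb ξ η n)
    exact ⟨l, hl⟩
  choose B hB using hex
  let L : H →L⋆[ℂ] H →L[ℂ] ℂ := LinearMap.mkContinuous₂
    (LinearMap.mk₂'ₛₗ (starRingEnd ℂ) (RingHom.id ℂ) B
      (fun ξ ξ' η => tendsto_nhds_unique (hB _ _) (by
        simpa [inner_add_left] using (hB ξ η).add (hB ξ' η)))
      (fun c ξ η => tendsto_nhds_unique (hB _ _) (by
        simpa [inner_smul_left, mul_comm] using (hB ξ η).const_mul (starRingEnd ℂ c)))
      (fun ξ η η' => tendsto_nhds_unique (hB _ _) (by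
        simpa [inner_add_right] using (hB ξ η).add (hB ξ η')))
      (fun c ξ η => tendsto_nhds_unique (hB _ _) (by
        simpa [inner_smul_right] using (hB ξ η).const_mul c))) K
    (fun ξ η => le_of_tendsto (hB ξ η).norm (Eventually.of_forall fun n => hb ξ η n))
  -- `B` was taken with the operator in the first slot, whereas `WeakLim` has it in the second;
  -- hence the conjugation.
  refine ⟨InnerProductSpace.continuousLinearMapOfBilin L, fun ξ η => ?_⟩
  have h1 : inner ℂ (InnerProductSpace.continuousLinearMapOfBilin L η) ξ = B η ξ := by
    rw [InnerProductSpace.continuousLinearMapOfBilin_apply]; rfl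
  rw [← inner_conj_symm, h1]
  have := (Complex.continuous_conj.tendsto _).comp (hB η ξ)
  refine this.congr fun n => ?_
  simp

end WeakLimits

/-! ### Normal functionals and the density theorem for them. -/

section NormalFunctionals

open Filter Topology

variable {H : Type*} [NormedAddCommGroup H] [InnerProductSpace ℂ H]

/-- A `σ`-weakly continuous functional on `B(H)`. -/
def IsNormalFunctional (φ : (H →L[ℂ] H) →ₗ[ℂ] ℂ) : Prop :=
  ∃ ξ η : ℕ → H, Summable (fun n => ‖ξ n‖ ^ 2) ∧ Summable (fun n => ‖η n‖ ^ 2) ∧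
    ∀ x : H →L[ℂ] H, HasSum (fun n => inner ℂ (ξ n) (x (η n))) (φ x)

variable {φ : (H →L[ℂ] H) →ₗ[ℂ] ℂ}

theorem summable_norm_clm_apply_sq {η : ℕ → H} (hη : Summable fun n => ‖η n‖ ^ 2)
    (x : H →L[ℂ] H) : Summable fun n => ‖x (η n)‖ ^ 2 := by
  refine (hη.mul_left (‖x‖ ^ 2)).of_nonneg_of_le (fun n => sq_nonneg _) fun n => ?_
  rw [← mul_pow]
  exact pow_le_pow_left₀ (norm_nonneg _) (x.le_opNorm _) 2

omit [InnerProductSpace ℂ H] in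
theorem summable_norm_mul_norm {ξ η : ℕ → H} (hξ : Summable fun n => ‖ξ n‖ ^ 2)
    (hη : Summable fun n => ‖η n‖ ^ 2) : Summable fun n => ‖ξ n‖ * ‖η n‖ := by
  refine (hξ.add hη).of_nonneg_of_le (fun n => by positivity) fun n => ?_
  nlinarith [sq_nonneg (‖ξ n‖ - ‖η n‖), sq_nonneg ‖ξ n‖, sq_nonneg ‖η n‖]

/-- The functional `x ↦ φ (b x c)`. -/
def compressFunctional (φ : (H →L[ℂ] H) →ₗ[ℂ] ℂ) (b c : H →L[ℂ] H) :
    (H →L[ℂ] H) →ₗ[ℂ] ℂ where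
  toFun x := φ (b * x * c)
  map_add' x y := by rw [mul_add, add_mul, map_add]
  map_smul' t x := by simp

theorem IsNormalFunctional.compress [CompleteSpace H] (h : IsNormalFunctional φ)
    (b c : H →L[ℂ] H) : IsNormalFunctional (compressFunctional φ b c) := by
  obtain ⟨ξ, η, hξ, hη, hs⟩ := h
  refine ⟨fun n => ContinuousLinearMap.adjoint b (ξ n), fun n => c (η n),
    summable_norm_clm_apply_sq hξ _, summable_norm_clm_apply_sq hη _, fun x => ?_⟩
  simpa [ContinuousLinearMap.adjoint_inner_left, compressFunctional] using hs (b * x * c)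

/-- Dominated convergence for the defining series; the uniform bound `K` supplies the dominating
series K‖ξₖ‖‖ηₖ‖. -/
theorem IsNormalFunctional.tendsto (h : IsNormalFunctional φ) {U : Filter ℕ}
    {y : ℕ → H →L[ℂ] H} {a : H →L[ℂ] H} {K : ℝ} (hy : ∀ n, ‖y n‖ ≤ K) (hl : WeakLim U y a) :
    Tendsto (fun n => φ (y n)) U (𝓝 (φ a)) := by
  obtain ⟨ξ, η, hξ, hη, hs⟩ := h
  have h1 : ∀ x, φ x = ∑' n, inner ℂ (ξ n) (x (η n)) := fun x => (hs x).tsum_eq.symm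
  simp only [h1]
  refine tendsto_tsum_of_dominated_convergence
    ((summable_norm_mul_norm hξ hη).mul_left K) (fun k => hl _ _)
    (Eventually.of_forall fun n k => ?_)
  refine (norm_inner_le_norm _ _).trans ?_
  calc ‖ξ k‖ * ‖y n (η k)‖ ≤ ‖ξ k‖ * (K * ‖η k‖) :=
        mul_le_mul_of_nonneg_left ((y n).le_of_opNorm_le (hy n) _) (norm_nonneg _)
    _ = K * (‖ξ k‖ * ‖η k‖) := by ring

/-- The diagonal action of an operator on `ℓ²(ℕ, H)`. -/
noncomputable def diagCLM (x : H →L[ℂ] H) :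
    lp (fun _ : ℕ => H) 2 →L[ℂ] lp (fun _ : ℕ => H) 2 :=
  lp.mapCLM 2 (fun _ => x) (norm_nonneg x) fun _ => le_rfl

theorem diagCLM_apply (x : H →L[ℂ] H) (f : lp (fun _ : ℕ => H) 2) (n : ℕ) :
    diagCLM x f n = x (f n) := rfl

omit [InnerProductSpace ℂ H] in
theorem memℓp_two_of_summable {η : ℕ → H} (hη : Summable fun n => ‖η n‖ ^ 2) :
    Memℓp η 2 := memℓp_gen (by simpa using hη)

theorem exists_isNormalFunctional {ξ η : ℕ → H} (hξ : Summable fun n => ‖ξ n‖ ^ 2)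
    (hη : Summable fun n => ‖η n‖ ^ 2) : ∃ φ : (H →L[ℂ] H) →ₗ[ℂ] ℂ, IsNormalFunctional φ ∧
      ∀ x : H →L[ℂ] H, HasSum (fun n => inner ℂ (ξ n) (x (η n))) (φ x) := by
  have hs : ∀ x : H →L[ℂ] H, Summable fun n => (inner ℂ (ξ n) (x (η n)) : ℂ) := fun x => by
    refine Summable.of_norm_bounded
      (summable_norm_mul_norm hξ (summable_norm_clm_apply_sq hη x)) fun n => norm_inner_le_norm _ _
  let φ : (H →L[ℂ] H) →ₗ[ℂ] ℂ :=
    { toFun := fun x => ∑' n, inner ℂ (ξ n) (x (η n))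
      map_add' := fun x y => by
        rw [← (hs x).tsum_add (hs y)]
        exact tsum_congr fun n => by simp
      map_smul' := fun c x => by
        simp only [RingHom.id_apply, smul_eq_mul]
        rw [← tsum_mul_left]
        exact tsum_congr fun n => by simp }
  exact ⟨φ, ⟨ξ, η, hξ, hη, fun x => (hs x).hasSum⟩, fun x => (hs x).hasSum⟩

/-- The density theorem: a normal functional that vanishes on a `*`-algebra vanishes on the
operators in its bicommutant that live under its unit. -/
theorem IsNormalFunctional.eq_zero_of_mem_bicommutant [CompleteSpace H]
    (h : IsNormalFunctional φ) (A : NonUnitalStarSubalgebra ℂ (H →L[ℂ] H)) {e : H →L[ℂ] H}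
    (heA : e ∈ A) (hA : ∀ x ∈ A, φ x = 0) {x : H →L[ℂ] H}
    (hx : x ∈ Set.centralizer (Set.centralizer (A : Set (H →L[ℂ] H)))) (hxe : x * e = x) :
    φ x = 0 := by
  obtain ⟨ξ, η, hξ, hη, hs⟩ := h
  let ξ' : lp (fun _ : ℕ => H) 2 := ⟨ξ, memℓp_two_of_summable hξ⟩
  let η' : lp (fun _ : ℕ => H) 2 := ⟨η, memℓp_two_of_summable hη⟩
  have hφ : ∀ a, φ a = inner ℂ ξ' (diagCLM a η') := fun a => by
    rw [lp.inner_eq_tsum]; exact (hs a).tsum_eq.symm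
  have hmul : ∀ a b : H →L[ℂ] H, ∀ f, diagCLM (a * b) f = diagCLM a (diagCLM b f) :=
    fun a b f => rfl
  -- On ℓ²(ℕ, H) the functional becomes a single matrix coefficient at ξ', η', so it suffices that
  -- diag(x)η' lies in the closure of diag(A)η'.
  let V₀ : Submodule ℂ (lp (fun _ : ℕ => H) 2) :=
    { carrier := {f | ∃ a ∈ A, f = diagCLM a η'}
      add_mem' := by
        rintro _ _ ⟨a, ha, rfl⟩ ⟨b, hb, rfl⟩
        exact ⟨a + b, add_mem ha hb, rfl⟩
      zero_mem' := ⟨0, zero_mem A, rfl⟩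
      smul_mem' := by
        rintro c _ ⟨a, ha, rfl⟩
        exact ⟨c • a, A.smul_mem' c ha, rfl⟩ }
  let V := V₀.topologicalClosure
  have hVc : IsClosed (V : Set (lp (fun _ : ℕ => H) 2)) := V₀.isClosed_topologicalClosure
  have : CompleteSpace V := hVc.completeSpace_coe
  have hinv : ∀ a ∈ A, ∀ f ∈ V, diagCLM a f ∈ V := by
    intro a ha f hf
    refine V₀.topologicalClosure.mem_carrier.1 ?_
    have hcl : Set.MapsTo (diagCLM a) (closure (V₀ : Set _)) (closure (V₀ : Set _)) := by
      refine Set.MapsTo.closure ?_ (diagCLM a).continuous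
      rintro _ ⟨b, hb, rfl⟩
      exact ⟨a * b, mul_mem ha hb, rfl⟩
    exact hcl hf
  have hadj : ∀ a : H →L[ℂ] H, ∀ f g, inner ℂ (diagCLM a f) g = inner ℂ f (diagCLM (star a) g) := by
    intro a f g
    rw [lp.inner_eq_tsum, lp.inner_eq_tsum]
    refine tsum_congr fun n => ?_
    rw [diagCLM_apply, diagCLM_apply, ContinuousLinearMap.star_eq_adjoint,
      ContinuousLinearMap.adjoint_inner_right]
  have hcomm : ∀ a ∈ A, ∀ f, V.starProjection (diagCLM a f) = diagCLM a (V.starProjection f) := by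
    intro a ha f
    refine Submodule.eq_starProjection_of_mem_of_inner_eq_zero
      (hinv a ha _ (V.starProjection_apply_mem f)) fun w hw => ?_
    rw [← map_sub, hadj]
    exact Submodule.starProjection_inner_eq_zero f _ (hinv _ (star_mem ha) w hw)
  let sg := fun n => lp.singleContinuousLinearMap ℂ (fun _ : ℕ => H) 2 n
  let ev := fun n => lp.evalCLM ℂ (fun _ : ℕ => H) 2 n
  have hsg : ∀ (a : H →L[ℂ] H) n ζ, diagCLM a (sg n ζ) = sg n (a ζ) := by
    intro a n ζ
    ext k
    rw [diagCLM_apply]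
    by_cases hk : k = n
    · subst hk; simp [sg]
    · simp [sg, Pi.single_eq_of_ne hk]
  -- The projection onto V commutes with diag(A), so its matrix entries lie in A'. An x in A''
  -- commutes with these entries, hence diag(x) commutes with the projection.
  have hentry : ∀ m n, (ev m).comp (V.starProjection.comp (sg n)) ∈
      Set.centralizer (A : Set (H →L[ℂ] H)) := by
    intro m n a ha
    ext ζ
    have h1 := congrArg (fun f : lp (fun _ : ℕ => H) 2 => f m) (hcomm a ha (sg n ζ))
    simp only [hsg, diagCLM_apply] at h1
    exact h1.symm
  have hxcomm : V.starProjection.comp (diagCLM x) = (diagCLM x).comp V.starProjection := by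
    refine lp.ext_continuousLinearMap (by simp) fun n => ?_
    ext ζ m
    have h1 := congrArg (fun T : H →L[ℂ] H => T ζ) (hx _ (hentry m n))
    have h2 : (V.starProjection (diagCLM x (sg n ζ))) m = x ((V.starProjection (sg n ζ)) m) := by
      rw [hsg]; exact h1
    exact h2
  -- Since A need not contain 1, η' itself may lie outside V; x = xe allows it to be replaced by
  -- diag(e)η'.
  have hη' : diagCLM x η' = diagCLM x (V.starProjection (diagCLM e η')) := by
    have : V.starProjection (diagCLM e η') = diagCLM e η' := by
      rw [Submodule.starProjection_eq_self_iff]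
      exact V₀.le_topologicalClosure ⟨e, heA, rfl⟩
    rw [this, ← hmul, hxe]
  have hmem : diagCLM x η' ∈ V := by
    rw [hη']
    have := congrArg (fun T => T (diagCLM e η')) hxcomm
    have h2 : V.starProjection (diagCLM x (diagCLM e η')) =
      diagCLM x (V.starProjection (diagCLM e η')) := this
    rw [← h2]
    exact V.starProjection_apply_mem _
  have hclosed : IsClosed {f : lp (fun _ : ℕ => H) 2 | inner ℂ ξ' f = 0} :=
    isClosed_eq (continuous_const.inner continuous_id) continuous_const
  rw [hφ]
  have hsub : closure (V₀ : Set (lp (fun _ : ℕ => H) 2)) ⊆ {f | inner ℂ ξ' f = 0} := by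
    refine closure_minimal ?_ hclosed
    rintro _ ⟨a, ha, rfl⟩
    show inner ℂ ξ' (diagCLM a η') = 0
    rw [← hφ, hA a ha]
  exact hsub hmem

end NormalFunctionals

/-! ### Weak closedness and functional calculus in von Neumann algebras with arbitrary unit. -/

section VNSubalgebraLemmas

variable {H : Type*} [NormedAddCommGroup H] [InnerProductSpace ℂ H] [CompleteSpace H]

theorem star_mem_centralizer_of_star_mem {S : Set (H →L[ℂ] H)} (hS : ∀ x ∈ S, star x ∈ S)
    {t : H →L[ℂ] H} (ht : t ∈ Set.centralizer S) : star t ∈ Set.centralizer S := fun x hx => by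
  have := congrArg star (ht (star x) (hS x hx))
  simpa using this.symm

namespace VNSubalgebra

variable (A : VNSubalgebra H)

theorem mem_iff_bicommutant {x : H →L[ℂ] H} : x ∈ A.toSet ↔
    x ∈ Set.centralizer (Set.centralizer A.toSet) ∧ A.unit * x = x ∧ x * A.unit = x :=
  ⟨fun h => ⟨fun _ hc => (hc x h).symm, A.unit_mul x h, A.mul_unit x h⟩,
    fun h => A.bicommutant x h.1 h.2.1 h.2.2⟩

theorem isClosed_toSet : IsClosed A.toSet := by
  have : A.toSet = Set.centralizer (Set.centralizer A.toSet) ∩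
      ({x | A.unit * x = x} ∩ {x | x * A.unit = x}) := by
    ext x
    exact A.mem_iff_bicommutant
  rw [this]
  exact (Set.isClosed_centralizer _).inter
    ((isClosed_eq (continuous_const.mul continuous_id) continuous_id).inter
      (isClosed_eq (continuous_id.mul continuous_const) continuous_id))

theorem weakLim_mem {U : Filter ℕ} [U.NeBot] {y : ℕ → H →L[ℂ] H} {a : H →L[ℂ] H}
    (h : WeakLim U y a) (hy : ∀ n, y n ∈ A.toSet) : a ∈ A.toSet := by
  refine A.mem_iff_bicommutant.2 ⟨fun c hc => ?_, ?_, ?_⟩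
  · refine (h.mul_left c).unique ?_
    have h1 : (fun n => c * y n) = fun n => y n * c := funext fun n => (hc _ (hy n)).symm
    rw [h1]
    exact h.mul_right c
  · refine (h.mul_left A.unit).unique ?_
    have h1 : (fun n => A.unit * y n) = y := funext fun n => A.unit_mul _ (hy n)
    rwa [h1]
  · refine (h.mul_right A.unit).unique ?_
    have h1 : (fun n => y n * A.unit) = y := funext fun n => A.mul_unit _ (hy n)
    rwa [h1]

theorem star_unit : star A.unit = A.unit := by
  have h1 : star A.unit ∈ A.toSet := A.star_mem' A.unit_mem
  have h2 := A.unit_mul _ h1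
  have h3 := congrArg star h2
  rw [star_mul, star_star] at h3
  rw [← h2]; exact h3

theorem cfcₙ_mem (f : ℝ → ℝ) {x : H →L[ℂ] H} (hx : x ∈ A.toSet) : cfcₙ f x ∈ A.toSet := by
  have hs : IsClosed (A.toNonUnitalStarSubalgebra : Set (H →L[ℂ] H)) := A.isClosed_toSet
  exact _root_.cfcₙ_mem (hs := hs) (s := A.toNonUnitalStarSubalgebra) f hx

theorem sqrt_mem {x : H →L[ℂ] H} (hx : x ∈ A.toSet) (hx0 : 0 ≤ x) : CFC.sqrt x ∈ A.toSet := by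
  rw [CFC.sqrt_eq_real_sqrt x]
  exact A.cfcₙ_mem _ hx

/-- Clamping a self-adjoint element of a von Neumann algebra to `[0, 1]`. -/
theorem exists_clamp {y : H →L[ℂ] H} (hy : y ∈ A.toSet) (hsa : IsSelfAdjoint y) :
    ∃ c ∈ A.toSet, ∃ d₁ ∈ A.toSet, ∃ d₂ ∈ A.toSet, 0 ≤ c ∧ c ≤ 1 ∧ 0 ≤ d₁ ∧ 0 ≤ d₂ ∧
      y = c + d₁ - d₂ ∧ c * d₁ = d₁ ∧ c * d₂ = 0 := by
  have hc : Continuous fun t : ℝ => max 0 (min t 1) := by fun_prop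
  have h1 : Continuous fun t : ℝ => max 0 (t - 1) := by fun_prop
  have h2 : Continuous fun t : ℝ => max 0 (-t) := by fun_prop
  -- t is its clamp plus (t − 1)₊ minus (−t)₊; the clamp is 1 where the first excess lives and 0
  -- where the second does. All three functions vanish at 0, so the non-unital calculus keeps them
  -- in A.
  refine ⟨cfcₙ (fun t : ℝ => max 0 (min t 1)) y, A.cfcₙ_mem _ hy,
    cfcₙ (fun t : ℝ => max 0 (t - 1)) y, A.cfcₙ_mem _ hy,
    cfcₙ (fun t : ℝ => max 0 (-t)) y, A.cfcₙ_mem _ hy,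
    cfcₙ_nonneg fun t _ => le_max_left _ _, ?_,
    cfcₙ_nonneg fun t _ => le_max_left _ _, cfcₙ_nonneg fun t _ => le_max_left _ _, ?_, ?_, ?_⟩
  · rw [cfcₙ_eq_cfc (hf := hc.continuousOn) (hf0 := by simp)]
    exact cfc_le_one _ _ fun t _ => max_le zero_le_one (min_le_right _ _)
  · rw [← cfcₙ_add _ _ _ hc.continuousOn (by simp) h1.continuousOn (by simp),
      ← cfcₙ_sub (fun t : ℝ => max 0 (min t 1) + max 0 (t - 1)) _ _ (hc.add h1).continuousOn
        (by simp) h2.continuousOn (by simp)]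
    conv_lhs => rw [← cfcₙ_id' ℝ y]
    refine cfcₙ_congr fun t _ => ?_
    rcases le_total t 0 with h | h
    · rw [min_eq_left (by linarith), max_eq_left h, max_eq_left (by linarith),
        max_eq_right (by linarith)]; ring
    · rcases le_total t 1 with h' | h'
      · rw [min_eq_left h', max_eq_right h, max_eq_left (by linarith),
          max_eq_left (by linarith)]; ring
      · rw [min_eq_right h', max_eq_right zero_le_one, max_eq_right (by linarith),
          max_eq_left (by linarith)]; ring
  · rw [← cfcₙ_mul _ _ _ hc.continuousOn (by simp) h1.continuousOn (by simp)]
    refine cfcₙ_congr fun t _ => ?_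
    rcases le_total t 1 with h | h
    · simp [max_eq_left (by linarith : t - 1 ≤ 0)]
    · simp [min_eq_right h]
  · rw [← cfcₙ_mul _ _ _ hc.continuousOn (by simp) h2.continuousOn (by simp),
      ← cfcₙ_zero ℝ y]
    refine cfcₙ_congr fun t _ => ?_
    rcases le_total t 0 with h | h
    · simp [min_eq_left (h.trans zero_le_one), max_eq_left h]
    · simp [max_eq_left (by linarith : -t ≤ 0)]

/-- The positive unit ball of a von Neumann algebra. -/
def posBall : Set (H →L[ℂ] H) := {x | x ∈ A.toSet ∧ 0 ≤ x ∧ x ≤ 1}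

theorem weakLim_mem_posBall {U : Filter ℕ} [U.NeBot] {y : ℕ → H →L[ℂ] H} {a : H →L[ℂ] H}
    (h : WeakLim U y a) (hy : ∀ n, y n ∈ A.posBall) : a ∈ A.posBall := by
  refine ⟨A.weakLim_mem h fun n => (hy n).1, h.nonneg fun n => (hy n).2.1, ?_⟩
  rw [← sub_nonneg]
  exact ((WeakLim.const 1).sub h).nonneg fun n => sub_nonneg.2 (hy n).2.2

end VNSubalgebra

theorem norm_le_one_of_nonneg_of_le_one {x : H →L[ℂ] H} (h0 : 0 ≤ x) (h1 : x ≤ 1) : ‖x‖ ≤ 1 :=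
  (CStarAlgebra.norm_le_one_iff_of_nonneg x).2 h1

end VNSubalgebraLemmas

/-! ### Traces and nearest points in the 2-norm. -/

section Trace

open Filter Topology

variable {H : Type*} [NormedAddCommGroup H] [InnerProductSpace ℂ H] [CompleteSpace H]

/-- A normal functional on `B(H)` whose restriction to `M` is a faithful trace. -/
structure IsTraceOn (M : VonNeumannAlgebra H) (φ : (H →L[ℂ] H) →ₗ[ℂ] ℂ) : Prop where
  normal : IsNormalFunctional φ
  nonneg : ∀ x ∈ M, 0 ≤ φ (star x * x)
  faithful : ∀ x ∈ M, φ (star x * x) = 0 → x = 0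
  trace : ∀ x ∈ M, ∀ y ∈ M, φ (x * y) = φ (y * x)

theorem VonNeumannAlgebra.smul_mem (M : VonNeumannAlgebra H) (c : ℂ) {x : H →L[ℂ] H} (hx : x ∈ M) :
    c • x ∈ M := M.toStarSubalgebra.smul_mem hx c

theorem VonNeumannAlgebra.sqrt_mem (M : VonNeumannAlgebra H) {x : H →L[ℂ] H} (hx : x ∈ M)
    (h0 : 0 ≤ x) : CFC.sqrt x ∈ M :=
  (VNSubalgebra.ofVonNeumannAlgebra M).sqrt_mem hx h0

/-- The square of the `2`-norm of a functional. -/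
noncomputable def sqNormTwo (φ : (H →L[ℂ] H) →ₗ[ℂ] ℂ) (x : H →L[ℂ] H) : ℝ := (φ (star x * x)).re

namespace IsTraceOn

variable {M : VonNeumannAlgebra H} {φ : (H →L[ℂ] H) →ₗ[ℂ] ℂ} (h : IsTraceOn M φ)

include h

theorem map_nonneg {x : H →L[ℂ] H} (hx : x ∈ M) (h0 : 0 ≤ x) : 0 ≤ φ x := by
  have h1 := h.nonneg _ (M.sqrt_mem hx h0)
  rwa [(CFC.sqrt_nonneg x).isSelfAdjoint.star_eq, CFC.sqrt_mul_sqrt_self x] at h1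

/-- By the trace property, φ(xy) = φ(x^{1/2} y x^{1/2}). -/
theorem map_mul_nonneg {x y : H →L[ℂ] H} (hx : x ∈ M) (hx0 : 0 ≤ x) (hy : y ∈ M) (hy0 : 0 ≤ y) :
    0 ≤ φ (x * y) := by
  have hs := M.sqrt_mem hx hx0
  have h1 : φ (x * y) = φ (star (CFC.sqrt x) * y * CFC.sqrt x) := by
    rw [(CFC.sqrt_nonneg x).isSelfAdjoint.star_eq, h.trace _ (mul_mem hs hy) _ hs, ← mul_assoc,
      CFC.sqrt_mul_sqrt_self x]
  rw [h1]
  exact h.map_nonneg (mul_mem (mul_mem (star_mem hs) hy) hs) (star_left_conjugate_nonneg hy0 _)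

/-- Polarization: φ is real on (x + 1)*(x + 1) and on (x + i)*(x + i), which relates the real and
imaginary parts of φ(x*) to those of φ(x). -/
theorem map_star {x : H →L[ℂ] H} (hx : x ∈ M) : φ (star x) = starRingEnd ℂ (φ x) := by
  have h0 := (Complex.nonneg_iff.1 (h.nonneg x hx)).2
  have h1 := (Complex.nonneg_iff.1 (h.nonneg (x + 1) (add_mem hx (one_mem M)))).2
  have h2 := (Complex.nonneg_iff.1 (h.nonneg (x + Complex.I • 1)
    (add_mem hx (M.smul_mem _ (one_mem M))))).2
  have h3 := (Complex.nonneg_iff.1 (h.nonneg 1 (one_mem M))).2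
  simp only [star_add, star_one, star_smul, add_mul, mul_add, mul_one, one_mul, map_add,
    Complex.add_im, map_smul, smul_mul_assoc, mul_smul_comm, smul_eq_mul, Complex.star_def,
    Complex.conj_I, Complex.mul_im, Complex.I_re, Complex.I_im, Complex.neg_re, Complex.neg_im,
    Complex.mul_re] at h0 h1 h2 h3
  apply Complex.ext
  · rw [Complex.conj_re]; linarith
  · rw [Complex.conj_im]; linarith

theorem sqNormTwo_nonneg {x : H →L[ℂ] H} (hx : x ∈ M) : 0 ≤ sqNormTwo φ x :=
  (Complex.nonneg_iff.1 (h.nonneg x hx)).1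

theorem map_star_mul_self {x : H →L[ℂ] H} (hx : x ∈ M) :
    φ (star x * x) = (sqNormTwo φ x : ℂ) :=
  Complex.ext rfl (by simpa using (Complex.nonneg_iff.1 (h.nonneg x hx)).2.symm)

/-- The Cauchy–Schwarz inequality for the `2`-norm. -/
theorem norm_map_star_mul_le {x y : H →L[ℂ] H} (hx : x ∈ M) (hy : y ∈ M) :
    ‖φ (star x * y)‖ ≤ √(sqNormTwo φ x) * √(sqNormTwo φ y) := by
  let core : PreInnerProductSpace.Core ℂ M.toStarSubalgebra :=
    { inner := fun x y => φ (star (x : H →L[ℂ] H) * y)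
      conj_inner_symm := fun x y => by
        rw [← h.map_star (mul_mem (star_mem y.2) x.2)]; simp
      re_inner_nonneg := fun x => h.sqNormTwo_nonneg x.2
      add_left := fun x y z => by simp [add_mul]
      smul_left := fun x y c => by simp }
  exact @InnerProductSpace.Core.norm_inner_le_norm ℂ M.toStarSubalgebra _ _ _ core ⟨x, hx⟩ ⟨y, hy⟩

theorem sqNormTwo_sub {x y : H →L[ℂ] H} (hx : x ∈ M) (hy : y ∈ M) :
    sqNormTwo φ (x - y) = sqNormTwo φ x + sqNormTwo φ y - 2 * (φ (star x * y)).re := by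
  have h1 : φ (star y * x) = starRingEnd ℂ (φ (star x * y)) := by
    rw [← h.map_star (mul_mem (star_mem hx) hy)]; simp
  simp only [sqNormTwo, star_sub, sub_mul, mul_sub, map_sub, Complex.sub_re, h1, Complex.conj_re]
  ring

theorem eq_zero_of_sqNormTwo_eq_zero {x : H →L[ℂ] H} (hx : x ∈ M) (h0 : sqNormTwo φ x = 0) :
    x = 0 := h.faithful x hx (by rw [h.map_star_mul_self hx, h0]; simp)

/-- Existence of the conditional expectation onto a `*`-subalgebra with weakly compact positive
unit ball `C`: the expectation of `x` is the point of `C` nearest to `x` in the `2`-norm. -/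
theorem exists_condExp_of_clamp (S : NonUnitalStarSubalgebra ℂ (H →L[ℂ] H))
    (hSM : ∀ x ∈ S, x ∈ M) (C : Set (H →L[ℂ] H)) (hC : ∀ c ∈ C, c ∈ S ∧ 0 ≤ c ∧ c ≤ 1)
    (hC0 : (0 : H →L[ℂ] H) ∈ C)
    (hlim : ∀ (U : Ultrafilter ℕ) (y : ℕ → H →L[ℂ] H) (a : H →L[ℂ] H),
      (∀ n, y n ∈ C) → WeakLim U y a → a ∈ C)
    (hclamp : ∀ y ∈ S, IsSelfAdjoint y → ∃ c ∈ C, ∃ d₁ ∈ S, ∃ d₂ ∈ S, 0 ≤ d₁ ∧ 0 ≤ d₂ ∧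
      y = c + d₁ - d₂ ∧ c * d₁ = d₁ ∧ c * d₂ = 0)
    {x : H →L[ℂ] H} (hx : x ∈ M) (hx0 : 0 ≤ x) (hx1 : x ≤ 1) :
    ∃ e ∈ C, ∀ y ∈ S, φ (e * y) = φ (x * y) := by
  have hCM : ∀ c ∈ C, c ∈ M := fun c hc => hSM _ (hC c hc).1
  set m := sInf ((fun c => sqNormTwo φ (x - c)) '' C) with hm
  have hbdd : BddBelow ((fun c => sqNormTwo φ (x - c)) '' C) :=
    ⟨0, by rintro _ ⟨c, hc, rfl⟩; exact h.sqNormTwo_nonneg (sub_mem hx (hCM c hc))⟩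
  have hmle : ∀ c ∈ C, m ≤ sqNormTwo φ (x - c) := fun c hc => csInf_le hbdd ⟨c, hc, rfl⟩
  have hseq : ∀ n : ℕ, ∃ c ∈ C, sqNormTwo φ (x - c) < m + 1 / ((n : ℝ) + 1) := by
    intro n
    obtain ⟨_, ⟨c, hc, rfl⟩, hlt⟩ := exists_lt_of_csInf_lt (⟨_, 0, hC0, rfl⟩ :
      ((fun c => sqNormTwo φ (x - c)) '' C).Nonempty)
      (show m < m + 1 / ((n : ℝ) + 1) by have : 0 < 1 / ((n : ℝ) + 1) := by positivity
                                         linarith)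
    exact ⟨c, hc, hlt⟩
  choose y hyC hym using hseq
  have hy1 : ∀ n, ‖y n‖ ≤ 1 := fun n =>
    norm_le_one_of_nonneg_of_le_one (hC _ (hyC n)).2.1 (hC _ (hyC n)).2.2
  obtain ⟨e, he⟩ := exists_weakLim (hyperfilter ℕ) y 1 hy1
  have heC : e ∈ C := hlim _ y e hyC he
  have heM := hCM e heC
  have hDM : x - e ∈ M := sub_mem hx heM
  have hDsa : star (x - e) = x - e := by
    rw [star_sub, hx0.isSelfAdjoint.star_eq, (hC e heC).2.1.isSelfAdjoint.star_eq]
  -- Weak lower semicontinuity: ‖x − e‖₂² is the limit of ⟨x − e, x − yₙ⟩, which Cauchy–Schwarz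
  -- bounds by ‖x − e‖₂ √(m + 1/(n+1)).
  have hmin : sqNormTwo φ (x - e) ≤ m := by
    have hw : WeakLim (hyperfilter ℕ : Filter ℕ) (fun n => star (x - e) * (x - y n))
        (star (x - e) * (x - e)) := ((WeakLim.const x).sub he).mul_left _
    have hK : ∀ n, ‖star (x - e) * (x - y n)‖ ≤ ‖star (x - e)‖ * (‖x‖ + 1) := fun n =>
      (norm_mul_le _ _).trans (mul_le_mul_of_nonneg_left
        ((norm_sub_le _ _).trans (by linarith [hy1 n])) (norm_nonneg _))
    have h1 := (h.normal.tendsto hK hw).norm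
    rw [h.map_star_mul_self hDM, Complex.norm_real, Real.norm_of_nonneg
      (h.sqNormTwo_nonneg hDM)] at h1
    have h2 : Tendsto (fun n : ℕ => √(sqNormTwo φ (x - e)) * √(m + 1 / ((n : ℝ) + 1)))
        (hyperfilter ℕ : Filter ℕ) (𝓝 (√(sqNormTwo φ (x - e)) * √(m + 0))) := by
      refine Tendsto.const_mul _ ((Real.continuous_sqrt.tendsto _).comp
        (tendsto_const_nhds.add ?_))
      refine Tendsto.mono_left tendsto_one_div_add_atTop_nhds_zero_nat ?_
      rw [← Nat.cofinite_eq_atTop]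
      exact hyperfilter_le_cofinite
    have h3 := le_of_tendsto_of_tendsto' h1 h2 fun n =>
      (h.norm_map_star_mul_le hDM (sub_mem hx (hCM _ (hyC n)))).trans
        (mul_le_mul_of_nonneg_left (Real.sqrt_le_sqrt (hym n).le) (Real.sqrt_nonneg _))
    rw [add_zero] at h3
    have hm0 : 0 ≤ m := le_csInf ⟨_, 0, hC0, rfl⟩ (by
      rintro _ ⟨c, hc, rfl⟩; exact h.sqNormTwo_nonneg (sub_mem hx (hCM c hc)))
    have hs := Real.mul_self_sqrt (h.sqNormTwo_nonneg hDM)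
    have hs' := Real.mul_self_sqrt hm0
    have : √(sqNormTwo φ (x - e)) ≤ √m := by
      by_contra hlt
      push Not at hlt
      have hpos : 0 < √(sqNormTwo φ (x - e)) := (Real.sqrt_nonneg _).trans_lt hlt
      nlinarith
    nlinarith [Real.sqrt_nonneg m, Real.sqrt_nonneg (sqNormTwo φ (x - e))]
  -- Clamping does not increase the distance to x: with s = c + d₁ − d₂, the cross term is (x −
  -- c)(d₁ − d₂) = −(1 − x)d₁ − x d₂, of trace at most 0. So e is nearest among all self-adjoint
  -- elements of S, not only those of C.
  have hminS : ∀ s ∈ S, IsSelfAdjoint s → sqNormTwo φ (x - e) ≤ sqNormTwo φ (x - s) := by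
    intro s hs hsa
    obtain ⟨c, hc, d₁, hd₁, d₂, hd₂, h1, h2, hsum, hcd₁, hcd₂⟩ := hclamp s hs hsa
    have hcM := hCM c hc
    have hd₁M := hSM _ hd₁
    have hd₂M := hSM _ hd₂
    have hxc : star (x - c) = x - c := by
      rw [star_sub, hx0.isSelfAdjoint.star_eq, (hC c hc).2.1.isSelfAdjoint.star_eq]
    have hsplit : x - s = (x - c) - (d₁ - d₂) := by rw [hsum]; abel
    have h3 := h.sqNormTwo_sub (sub_mem hx hcM) (sub_mem hd₁M hd₂M)
    have h4 : (x - c) * (d₁ - d₂) = -((1 - x) * d₁) - x * d₂ := by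
      rw [sub_mul, mul_sub, mul_sub, hcd₁, hcd₂, sub_mul, one_mul]; abel
    have h5 := (Complex.nonneg_iff.1 (h.map_mul_nonneg (sub_mem (one_mem M) hx)
      (sub_nonneg.2 hx1) hd₁M h1)).1
    have h6 := (Complex.nonneg_iff.1 (h.map_mul_nonneg hx hx0 hd₂M h2)).1
    rw [hxc, h4] at h3
    simp only [map_sub, map_neg, Complex.sub_re, Complex.neg_re] at h3
    have h7 := h.sqNormTwo_nonneg (sub_mem hd₁M hd₂M)
    have h8 := hmle c hc
    rw [hsplit]
    linarith
  have horth : ∀ s ∈ S, IsSelfAdjoint s → φ ((x - e) * s) = 0 := by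
    intro s hs hsa
    have hsM := hSM _ hs
    -- First variation at e in the direction s; a non-negative quadratic without constant term has
    -- no linear term. This kills the real part, and the imaginary part vanishes because both
    -- factors are self-adjoint.
    have hquad : ∀ t : ℝ, 0 ≤ sqNormTwo φ s * (t * t) + (-2 * (φ ((x - e) * s)).re) * t + 0 := by
      intro t
      have hts : ((t : ℂ) • s) ∈ S := S.smul_mem' _ hs
      have htsa : IsSelfAdjoint ((t : ℂ) • s) := by
        rw [IsSelfAdjoint, star_smul, hsa.star_eq]; simp
      have h1 := hminS _ (add_mem (hC e heC).1 hts)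
        ((hC e heC).2.1.isSelfAdjoint.add htsa)
      rw [← sub_sub, h.sqNormTwo_sub hDM (hSM _ hts), hDsa] at h1
      have h2 : sqNormTwo φ ((t : ℂ) • s) = t * t * sqNormTwo φ s := by
        simp [sqNormTwo, mul_assoc]
      have h3 : (φ ((x - e) * ((t : ℂ) • s))).re = t * (φ ((x - e) * s)).re := by
        simp
      rw [h2, h3] at h1
      linarith
    have hdisc := discrim_le_zero hquad
    have hre : (φ ((x - e) * s)).re = 0 := by
      rw [discrim] at hdisc
      nlinarith [sq_nonneg (φ ((x - e) * s)).re]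
    have him : (φ ((x - e) * s)).im = 0 := by
      have h1 := h.map_star (mul_mem hDM hsM)
      rw [star_mul, hDsa, hsa.star_eq, h.trace _ hsM _ hDM] at h1
      have h2 := congrArg Complex.im h1
      rw [Complex.conj_im] at h2
      linarith
    exact Complex.ext hre him
  refine ⟨e, heC, fun s hs => ?_⟩
  have h1 := horth (s + star s) (add_mem hs (star_mem hs)) (IsSelfAdjoint.add_star_self s)
  have h2 := horth (Complex.I • (s - star s))
    (S.smul_mem' _ (sub_mem hs (star_mem hs))) (by
      rw [IsSelfAdjoint, star_smul, star_sub, star_star, Complex.star_def, Complex.conj_I,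
        neg_smul, ← smul_neg, neg_sub])
  rw [mul_smul_comm, map_smul, smul_eq_mul, mul_eq_zero] at h2
  replace h2 := h2.resolve_left Complex.I_ne_zero
  rw [mul_add, map_add] at h1
  rw [mul_sub, map_sub] at h2
  have h3 : φ ((x - e) * s) = 0 := by linear_combination (h1 + h2) / 2
  rw [sub_mul, map_sub, sub_eq_zero] at h3
  exact h3.symm

end IsTraceOn

end Trace

/-! ### Conditional expectations: uniqueness, bimodularity, existence, positivity. -/

section ConditionalExpectation

variable {H : Type*} [NormedAddCommGroup H] [InnerProductSpace ℂ H] [CompleteSpace H]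

/-- `e` is the `φ`-preserving conditional expectation of `x` onto `S`. -/
def IsCondExpOn (φ : (H →L[ℂ] H) →ₗ[ℂ] ℂ) (S : Set (H →L[ℂ] H)) (x e : H →L[ℂ] H) : Prop :=
  e ∈ S ∧ ∀ y ∈ S, φ (e * y) = φ (x * y)

variable {φ : (H →L[ℂ] H) →ₗ[ℂ] ℂ} {M : VonNeumannAlgebra H}
  {S : NonUnitalStarSubalgebra ℂ (H →L[ℂ] H)} {x x' e e' a : H →L[ℂ] H}

namespace IsCondExpOn

theorem add (h : IsCondExpOn φ S x e) (h' : IsCondExpOn φ S x' e') :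
    IsCondExpOn φ S (x + x') (e + e') :=
  ⟨add_mem h.1 h'.1, fun y hy => by rw [add_mul, add_mul, map_add, map_add, h.2 y hy, h'.2 y hy]⟩

theorem smul (h : IsCondExpOn φ S x e) (c : ℂ) : IsCondExpOn φ S (c • x) (c • e) :=
  ⟨S.smul_mem' c h.1, fun y hy => by
    rw [smul_mul_assoc, smul_mul_assoc, map_smul, map_smul, h.2 y hy]⟩

theorem sub (h : IsCondExpOn φ S x e) (h' : IsCondExpOn φ S x' e') :
    IsCondExpOn φ S (x - x') (e - e') :=
  ⟨sub_mem h.1 h'.1, fun y hy => by rw [sub_mul, sub_mul, map_sub, map_sub, h.2 y hy, h'.2 y hy]⟩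

variable (hφ : IsTraceOn M φ) (hSM : ∀ y ∈ S, y ∈ M)

include hφ hSM

/-- Testing with y = (e − e')* gives trace zero, and the trace is faithful. -/
theorem unique (h : IsCondExpOn φ S x e) (h' : IsCondExpOn φ S x e') : e = e' := by
  have hm : e - e' ∈ S := sub_mem h.1 h'.1
  have h1 : φ ((e - e') * star (e - e')) = 0 := by
    rw [sub_mul, map_sub, h.2 _ (star_mem hm), h'.2 _ (star_mem hm), sub_self]
  have h2 := hφ.faithful (star (e - e')) (star_mem (hSM _ hm)) (by rwa [star_star])
  rw [star_eq_zero, sub_eq_zero] at h2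
  exact h2

/-- The trace property moves `a` to the right-hand side, where it is absorbed into the test element.
-/
theorem mul_left (h : IsCondExpOn φ S x e) (hx : x ∈ M) (ha : a ∈ S) :
    IsCondExpOn φ S (a * x) (a * e) :=
  ⟨mul_mem ha h.1, fun y hy => by
    rw [mul_assoc, hφ.trace _ (hSM a ha) _ (mul_mem (hSM _ h.1) (hSM y hy)), mul_assoc,
      h.2 _ (mul_mem hy ha), mul_assoc a, hφ.trace _ (hSM a ha) _ (mul_mem hx (hSM y hy)),
      mul_assoc]⟩

omit hφ hSM in
theorem mul_right (h : IsCondExpOn φ S x e) (ha : a ∈ S) :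
    IsCondExpOn φ S (x * a) (e * a) :=
  ⟨mul_mem h.1 ha, fun y hy => by rw [mul_assoc, mul_assoc, h.2 _ (mul_mem ha hy)]⟩

end IsCondExpOn

variable (hφ : IsTraceOn M φ)

/-- Conditional expectations exist as soon as they exist for positive contractions. -/
theorem exists_isCondExpOn_of_contraction
    (hex : ∀ x ∈ M, 0 ≤ x → x ≤ 1 → ∃ e, 0 ≤ e ∧ IsCondExpOn φ S x e) (hx : x ∈ M) :
    (∃ e, IsCondExpOn φ S x e) ∧ (0 ≤ x → ∃ e, 0 ≤ e ∧ IsCondExpOn φ S x e) := by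
  have hpos : ∀ x ∈ M, 0 ≤ x → ∃ e, 0 ≤ e ∧ IsCondExpOn φ S x e := by
    intro x hx h0
    -- The added 1 keeps the scaling factor non-zero when x = 0.
    set K : ℝ := ‖x‖ + 1 with hK
    have hK0 : 0 < K := by positivity
    have hKC : (K : ℂ) ≠ 0 := by exact_mod_cast hK0.ne'
    have hinv : (0 : ℂ) ≤ ((K : ℂ))⁻¹ := by
      rw [← Complex.ofReal_inv]; exact_mod_cast (inv_pos.2 hK0).le
    have hle : ((K : ℂ)⁻¹ • x) ≤ 1 := by
      have h1 : 0 ≤ ((K : ℂ)⁻¹ • x) := smul_nonneg hinv h0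
      refine (CStarAlgebra.norm_le_one_iff_of_nonneg _ h1).1 ?_
      rw [norm_smul, norm_inv, Complex.norm_real, Real.norm_of_nonneg hK0.le,
        inv_mul_le_iff₀ hK0]
      linarith
    obtain ⟨e, he0, he⟩ := hex _ (M.smul_mem (K : ℂ)⁻¹ hx) (smul_nonneg hinv h0) hle
    refine ⟨(K : ℂ) • e, smul_nonneg (by exact_mod_cast hK0.le) he0, ?_⟩
    have := he.smul (K : ℂ)
    rwa [smul_inv_smul₀ hKC] at this
  have hsa : ∀ x ∈ M, IsSelfAdjoint x → ∃ e, IsCondExpOn φ S x e := by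
    intro x hx hs
    have hn : (algebraMap ℝ (H →L[ℂ] H) ‖x‖) = ((‖x‖ : ℂ) • 1) := by
      rw [Algebra.algebraMap_eq_smul_one]; exact (RCLike.real_smul_eq_coe_smul (K := ℂ) _ _)
    have h1 : 0 ≤ x + (‖x‖ : ℂ) • (1 : H →L[ℂ] H) := by
      have := hs.neg_algebraMap_norm_le_self
      rw [hn, neg_le_iff_add_nonneg] at this
      exact this
    have h2 : (0 : H →L[ℂ] H) ≤ (‖x‖ : ℂ) • (1 : H →L[ℂ] H) := by
      rw [← hn]; exact algebraMap_nonneg _ (norm_nonneg _)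
    have hm := M.smul_mem (‖x‖ : ℂ) (one_mem M)
    obtain ⟨e, -, he⟩ := hpos _ (add_mem hx hm) h1
    obtain ⟨e', -, he'⟩ := hpos _ hm h2
    exact ⟨e - e', by simpa using he.sub he'⟩
  refine ⟨?_, hpos x hx⟩
  obtain ⟨e, he⟩ := hsa (x + star x) (add_mem hx (star_mem hx)) (IsSelfAdjoint.add_star_self x)
  obtain ⟨e', he'⟩ := hsa (Complex.I • (x - star x))
    (M.smul_mem _ (sub_mem hx (star_mem hx))) (by
      rw [IsSelfAdjoint, star_smul, star_sub, star_star, Complex.star_def, Complex.conj_I,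
        neg_smul, ← smul_neg, neg_sub])
  refine ⟨(2 : ℂ)⁻¹ • (e + (-Complex.I) • e'), ?_⟩
  have := (he.add (he'.smul (-Complex.I))).smul (2 : ℂ)⁻¹
  rw [smul_smul, neg_mul, Complex.I_mul_I, neg_neg, one_smul, add_add_sub_cancel,
    ← two_smul ℂ x, inv_smul_smul₀ two_ne_zero] at this
  exact this

include hφ in
theorem VNSubalgebra.exists_isCondExpOn (A : VNSubalgebra H) (hAM : ∀ y ∈ A.toSet, y ∈ M)
    (hx : x ∈ M) :
    (∃ e, IsCondExpOn φ A.toSet x e) ∧ (0 ≤ x → ∃ e, 0 ≤ e ∧ IsCondExpOn φ A.toSet x e) := by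
  refine exists_isCondExpOn_of_contraction (S := A.toNonUnitalStarSubalgebra) ?_ hx
  intro x hx h0 h1
  obtain ⟨e, he, hφe⟩ := hφ.exists_condExp_of_clamp A.toNonUnitalStarSubalgebra hAM A.posBall
    (fun c hc => hc) ⟨zero_mem A.toNonUnitalStarSubalgebra, le_rfl, zero_le_one⟩
    (fun U y a hy hl => A.weakLim_mem_posBall hl hy) (fun y hy hsa => by
      obtain ⟨c, hc, d₁, hd₁, d₂, hd₂, h1, h2, h3, h4, h5, h6, h7⟩ := A.exists_clamp hy hsa
      exact ⟨c, ⟨hc, h1, h2⟩, d₁, hd₁, d₂, hd₂, h3, h4, h5, h6, h7⟩) hx h0 h1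
  exact ⟨e, he.2.1, he.1, hφe⟩

include hφ in
-- The constructed expectation of a positive element is positive, since it comes from the positive
-- ball; uniqueness transfers this to `e`.
theorem IsCondExpOn.nonneg {A : VNSubalgebra H} (hAM : ∀ y ∈ A.toSet, y ∈ M)
    (h : IsCondExpOn φ A.toSet x e) (hx : x ∈ M) (h0 : 0 ≤ x) : 0 ≤ e := by
  obtain ⟨e', he', h'⟩ := (A.exists_isCondExpOn hφ hAM hx).2 h0
  rwa [IsCondExpOn.unique (S := A.toNonUnitalStarSubalgebra) hφ hAM h h']

end ConditionalExpectation

/-! ### Range projections, spectral projections and polar decomposition. -/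

section Projections

variable {H : Type*} [NormedAddCommGroup H] [InnerProductSpace ℂ H] [CompleteSpace H]

theorem commute_starProjection (V : Submodule ℂ H) [V.HasOrthogonalProjection] {b : H →L[ℂ] H}
    (h : ∀ v ∈ V, b v ∈ V) (h' : ∀ v ∈ V, star b v ∈ V) : Commute b V.starProjection := by
  ext ζ
  symm
  refine Submodule.eq_starProjection_of_mem_of_inner_eq_zero
    (h _ (V.starProjection_apply_mem ζ)) fun w hw => ?_
  show inner ℂ (b ζ - b (V.starProjection ζ)) w = 0
  rw [← map_sub, ← ContinuousLinearMap.adjoint_inner_right]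
  exact Submodule.starProjection_inner_eq_zero ζ _ (h' w hw)

/-- The projection onto the closed span of the ranges of a family of operators. -/
theorem exists_rangeProjection (F : Set (H →L[ℂ] H)) : ∃ R : H →L[ℂ] H, IsStarProjection R ∧
    (∀ T ∈ F, R * T = T) ∧ (∀ x, (∀ T ∈ F, x * T = 0) → x * R = 0) ∧
    ∀ b, (∀ T ∈ F, ∃ T' ∈ F, ∃ c, b * T = T' * c) →
      (∀ T ∈ F, ∃ T' ∈ F, ∃ c, star b * T = T' * c) → Commute b R := by
  let V₀ : Submodule ℂ H := Submodule.span ℂ {ζ | ∃ T ∈ F, ∃ η, T η = ζ}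
  let V := V₀.topologicalClosure
  have : CompleteSpace V := V₀.isClosed_topologicalClosure.completeSpace_coe
  have hclos : ∀ (W : Submodule ℂ H), IsClosed (W : Set H) → (∀ T ∈ F, ∀ η, T η ∈ W) →
      ∀ v ∈ V, v ∈ W := by
    intro W hW hF v hv
    refine (V₀.topologicalClosure_minimal ?_ hW) hv
    refine Submodule.span_le.2 ?_
    rintro _ ⟨T, hT, η, rfl⟩
    exact hF T hT η
  have hTV : ∀ T ∈ F, ∀ η, T η ∈ V := fun T hT η =>
    V₀.le_topologicalClosure (Submodule.subset_span ⟨T, hT, η, rfl⟩)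
  have hinv : ∀ b : H →L[ℂ] H, (∀ T ∈ F, ∃ T' ∈ F, ∃ c, b * T = T' * c) → ∀ v ∈ V, b v ∈ V := by
    intro b hb v hv
    refine hclos (V.comap (b : H →ₗ[ℂ] H))
      (V₀.isClosed_topologicalClosure.preimage b.continuous) ?_ v hv
    intro T hT η
    obtain ⟨T', hT', c, hc⟩ := hb T hT
    have : b (T η) = T' (c η) := congrArg (fun X : H →L[ℂ] H => X η) hc
    show b (T η) ∈ V
    rw [this]
    exact hTV T' hT' _
  refine ⟨V.starProjection, isStarProjection_starProjection, fun T hT => ?_, fun x hx => ?_,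
    fun b hb hb' => commute_starProjection V (hinv b hb) (hinv _ hb')⟩
  · ext η
    exact Submodule.starProjection_eq_self_iff.2 (hTV T hT η)
  · ext η
    refine hclos (LinearMap.ker (x : H →ₗ[ℂ] H)) x.isClosed_ker ?_ _
      (V.starProjection_apply_mem η)
    intro T hT η
    exact congrArg (fun X : H →L[ℂ] H => X η) (hx T hT)

/-- A positive non-zero operator has a spectral projection on which it is bounded below. -/
theorem exists_spectralProjection {E : H →L[ℂ] H} (h0 : 0 ≤ E) (hE : E ≠ 0) :
    ∃ (s : ℝ) (r : H →L[ℂ] H), 0 < s ∧ IsStarProjection r ∧ r ≠ 0 ∧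
      (∀ b, Commute b E → Commute b r) ∧ (s : ℂ) • r ≤ E * r := by
  -- Any value strictly between 0 and ‖E‖ would do: r is the range projection of (E − s)₊, and r = 0
  -- would give E ≤ s < ‖E‖.
  set s : ℝ := ‖E‖ / 2 with hs
  have hEn : 0 < ‖E‖ := norm_pos_iff.2 hE
  have hs0 : 0 < s := half_pos hEn
  have hEsa : IsSelfAdjoint E := h0.isSelfAdjoint
  have hch : Continuous fun t : ℝ => max 0 (t - s) := by fun_prop
  have hck : Continuous fun t : ℝ => max 0 (s - t) := by fun_prop
  set h := cfc (fun t : ℝ => max 0 (t - s)) E with hh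
  set k := cfc (fun t : ℝ => max 0 (s - t)) E with hk
  have hh0 : 0 ≤ h := cfc_nonneg fun t _ => le_max_left _ _
  have hk0 : 0 ≤ k := cfc_nonneg fun t _ => le_max_left _ _
  have hsub : E - algebraMap ℝ _ s = h - k := by
    rw [hh, hk, ← cfc_sub _ _ _ hch.continuousOn hck.continuousOn]
    have h1 : E - algebraMap ℝ _ s = cfc (fun t : ℝ => t - s) E := by
      rw [cfc_sub (fun t : ℝ => t) (fun _ => s) E continuousOn_id continuousOn_const,
        cfc_id' ℝ E hEsa, cfc_const s E hEsa]
    rw [h1]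
    refine cfc_congr fun t _ => ?_
    rcases le_total t s with h' | h'
    · rw [max_eq_left (by linarith), max_eq_right (by linarith)]; ring
    · rw [max_eq_right (by linarith), max_eq_left (by linarith)]; ring
  have hkh : k * h = 0 := by
    rw [hh, hk, ← cfc_mul _ _ _ hck.continuousOn hch.continuousOn, ← cfc_zero ℝ E]
    refine cfc_congr fun t _ => ?_
    rcases le_total t s with h' | h'
    · simp [max_eq_left (by linarith : t - s ≤ 0)]
    · simp [max_eq_left (by linarith : s - t ≤ 0)]
  obtain ⟨r, hr, hrh, hrz, hrc⟩ := exists_rangeProjection {h}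
  have hrh' : r * h = h := hrh h rfl
  have hhr : h * r = h := by
    have := congrArg star hrh'
    rwa [star_mul, hr.isSelfAdjoint.star_eq, hh0.isSelfAdjoint.star_eq] at this
  have hkr : k * r = 0 := hrz k fun T hT => by rw [Set.mem_singleton_iff.1 hT, hkh]
  have hEr : E * r - (s : ℂ) • r = h := by
    have h1 : (s : ℂ) • r = algebraMap ℝ (H →L[ℂ] H) s * r := by
      rw [Algebra.algebraMap_eq_smul_one, smul_mul_assoc, one_mul]
      exact (RCLike.real_smul_eq_coe_smul (K := ℂ) _ _).symm
    rw [h1, ← sub_mul, hsub, sub_mul, hhr, hkr, sub_zero]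
  have hbh : ∀ b, Commute b E → Commute b h := fun b hb => (hb.symm.cfc_real _).symm
  refine ⟨s, r, hs0, hr, ?_, ?_, ?_⟩
  · rintro rfl
    rw [zero_mul] at hrh'
    rw [← hrh', zero_sub] at hsub
    have hle : E ≤ algebraMap ℝ _ s := by
      rw [← sub_nonpos, hsub]; exact neg_nonpos.2 hk0
    have := (CStarAlgebra.norm_le_iff_le_algebraMap E hs0.le h0).2 hle
    linarith
  · intro b hb
    have hb' : Commute (star b) E := by
      have := congrArg star hb.eq
      simp only [star_mul, h0.isSelfAdjoint.star_eq] at this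
      exact this.symm
    refine hrc b ?_ ?_
    · intro T hT
      rw [Set.mem_singleton_iff.1 hT]
      exact ⟨h, rfl, b, hbh b hb⟩
    · intro T hT
      rw [Set.mem_singleton_iff.1 hT]
      exact ⟨h, rfl, star b, hbh _ hb'⟩
  · rw [← sub_nonneg, hEr]; exact hh0

/-- The polar decomposition. -/
theorem exists_polarDecomposition (T : H →L[ℂ] H) : ∃ w : H →L[ℂ] H,
    w * CFC.sqrt (star T * T) = T ∧ IsStarProjection (star w * w) ∧ w * (star w * w) = w ∧
    ∀ b c, b * T = T * c → Commute c (star T * T) → b * w = w * c := by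
  set a := CFC.sqrt (star T * T) with ha
  have hTT : 0 ≤ star T * T := star_mul_self_nonneg T
  have ha0 : 0 ≤ a := CFC.sqrt_nonneg _
  have haa : a * a = star T * T := CFC.sqrt_mul_sqrt_self _ hTT
  let ε : ℕ → ℝ := fun n => 1 / ((n : ℝ) + 1)
  have hε : ∀ n, 0 < ε n := fun n => by positivity
  -- w will be a weak limit of the contractions T(|T| + ε)⁻¹. Intertwining relations hold for each
  -- of them and pass to the limit. The absolute value only makes the function continuous on all of
  -- ℝ.
  let G : ℕ → H →L[ℂ] H := fun n => cfc (fun t : ℝ => (|t| + ε n)⁻¹) a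
  have hcont : ∀ n, Continuous fun t : ℝ => (|t| + ε n)⁻¹ := fun n =>
    (continuous_abs.add continuous_const).inv₀ fun t =>
      (add_pos_of_nonneg_of_pos (abs_nonneg t) (hε n)).ne'
  have hGa : ∀ n, a * G n = cfc (fun t : ℝ => t * (|t| + ε n)⁻¹) a := fun n => by
    rw [cfc_mul (fun t : ℝ => t) _ a continuousOn_id (hcont n).continuousOn, cfc_id' ℝ a]
  have hGsa : ∀ n, IsSelfAdjoint (G n) := fun n => cfc_predicate _ _
  have hcomm : ∀ c, Commute c (star T * T) → ∀ n, Commute c (G n) := by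
    intro c hc n
    have h1 : Commute c a := by
      rw [ha, CFC.sqrt_eq_cfc]; exact (hc.symm.cfc_nnreal _).symm
    exact (h1.symm.cfc_real _).symm
  have hnormGa : ∀ n, ‖a * G n‖ ≤ 1 := by
    intro n
    rw [hGa]
    refine norm_cfc_le zero_le_one fun t _ => ?_
    have : 0 < |t| + ε n := add_pos_of_nonneg_of_pos (abs_nonneg t) (hε n)
    rw [Real.norm_eq_abs, abs_mul, abs_inv, abs_of_pos this, ← div_eq_mul_inv, div_le_one this]
    linarith [hε n]
  have hnorm : ∀ n, ‖T * G n‖ ≤ 1 := by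
    intro n
    have h1 : star (T * G n) * (T * G n) = star (a * G n) * (a * G n) := by
      simp only [star_mul, (hGsa n).star_eq, ha0.isSelfAdjoint.star_eq]
      calc G n * star T * (T * G n) = G n * (star T * T) * G n := by simp only [mul_assoc]
        _ = G n * a * (a * G n) := by rw [← haa]; simp only [mul_assoc]
    have h2 : ‖T * G n‖ * ‖T * G n‖ = ‖a * G n‖ * ‖a * G n‖ := by
      rw [← CStarRing.norm_star_mul_self, h1, CStarRing.norm_star_mul_self]
    have h3 : ‖T * G n‖ = ‖a * G n‖ := (mul_self_inj (norm_nonneg _) (norm_nonneg _)).1 h2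
    exact h3 ▸ hnormGa n
  obtain ⟨w, hw⟩ := exists_weakLim (Filter.hyperfilter ℕ) (fun n => T * G n) 1 hnorm
  have hint : ∀ b c, b * T = T * c → Commute c (star T * T) → b * w = w * c := by
    intro b c hbc hc
    refine (hw.mul_left b).unique ?_
    have h1 : (fun n => b * (T * G n)) = fun n => T * G n * c := funext fun n => by
      rw [← mul_assoc, hbc, mul_assoc, (hcomm c hc n).eq, mul_assoc]
    rw [h1]
    exact hw.mul_right c
  have hwa : w * a = T := by
    refine (hw.mul_right a).unique (WeakLim.of_tendsto ?_)
    have h1 : ∀ n, T * G n * a = T - (ε n) • (T * G n) := by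
      intro n
      have h2 : G n * a = 1 - ε n • G n := by
        have h3 : G n * (a + algebraMap ℝ _ (ε n)) = 1 := by
          have h4 : a + algebraMap ℝ _ (ε n) = cfc (fun t : ℝ => |t| + ε n) a := by
            rw [cfc_add_const (ε n) (fun t : ℝ => |t|) a continuous_abs.continuousOn]
            congr 1
            conv_lhs => rw [← cfc_id' ℝ a]
            exact cfc_congr fun t ht => (abs_of_nonneg (spectrum_nonneg_of_nonneg ha0 ht)).symm
          rw [h4, ← cfc_mul _ (fun t : ℝ => |t| + ε n) a (hcont n).continuousOn
            (continuous_abs.add continuous_const).continuousOn, ← cfc_one ℝ a]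
          exact cfc_congr fun t _ => inv_mul_cancel₀
            (add_pos_of_nonneg_of_pos (abs_nonneg t) (hε n)).ne'
        rw [mul_add, Algebra.algebraMap_eq_smul_one, mul_smul_comm, mul_one] at h3
        exact eq_sub_of_add_eq h3
      rw [mul_assoc, h2, mul_sub, mul_one, mul_smul_comm]
    simp only [h1]
    have h5 : Filter.Tendsto (fun n => ε n • (T * G n)) (Filter.hyperfilter ℕ : Filter ℕ)
        (nhds 0) := by
      refine squeeze_zero_norm (a := ε) (fun n => ?_) ?_
      · rw [norm_smul, Real.norm_of_nonneg (hε n).le]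
        exact mul_le_of_le_one_right (hε n).le (hnorm n)
      · refine Filter.Tendsto.mono_left tendsto_one_div_add_atTop_nhds_zero_nat ?_
        rw [← Nat.cofinite_eq_atTop]
        exact Filter.hyperfilter_le_cofinite
    simpa using (tendsto_const_nhds (x := T)).sub h5
  obtain ⟨R, hR, hRa, hRz, -⟩ := exists_rangeProjection {a}
  have hRs := hR.isSelfAdjoint.star_eq
  have hRa' : R * a = a := hRa a rfl
  have haR : a * R = a := by
    have := congrArg star hRa'
    rwa [star_mul, hRs, ha0.isSelfAdjoint.star_eq] at this
  have hTR : T * R = T := by rw [← hwa, mul_assoc, haR]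
  have hwR : w = w * R := by
    have := hint 1 R (by rw [one_mul, hTR]) (by
      rw [Commute, SemiconjBy, ← haa, ← mul_assoc, hRa', mul_assoc, haR])
    rwa [one_mul] at this
  -- Since R is the range projection of a, each outer factor a may be replaced by R; as w = wR, this
  -- gives w*w = R.
  have hX : a * (star w * w - 1) * a = 0 := by
    have h1 : star T * T = a * (star w * w) * a := by
      conv_lhs => rw [← hwa]
      rw [star_mul, ha0.isSelfAdjoint.star_eq]; simp only [mul_assoc]
    rw [mul_sub, sub_mul, ← h1, mul_one, haa, sub_self]
  have hXR : a * (star w * w - 1) * R = 0 := hRz _ fun T' hT' => by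
    rw [Set.mem_singleton_iff.1 hT', hX]
  have hXR' : R * (star w * w - 1) * R = 0 := by
    refine hRz _ fun T' hT' => ?_
    rw [Set.mem_singleton_iff.1 hT']
    have := congrArg star hXR
    simpa [hRs, ha0.isSelfAdjoint.star_eq, mul_assoc] using this
  have hww : star w * w = R := by
    have h1 : R * (star w * w) * R = star w * w := by
      have h2 : star w = R * star w := by
        conv_lhs => rw [hwR]
        rw [star_mul, hRs]
      rw [← mul_assoc, ← h2, mul_assoc, ← hwR]
    rw [mul_sub, sub_mul, h1, mul_one, hR.isIdempotentElem.eq, sub_eq_zero] at hXR'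
    exact hXR'
  exact ⟨w, hwa, hww ▸ hR, by rw [hww, ← hwR], hint⟩

end Projections

/-! ### Generated algebras, relative commutants, supports and images as von Neumann algebras. -/

section Constructions

variable {H : Type*} [NormedAddCommGroup H] [InnerProductSpace ℂ H] [CompleteSpace H]

omit [CompleteSpace H] in
theorem sub_mem_centralizer_clm {S : Set (H →L[ℂ] H)} {x y : H →L[ℂ] H}
    (hx : x ∈ Set.centralizer S) (hy : y ∈ Set.centralizer S) :
    x - y ∈ Set.centralizer S := fun z hz => by
  rw [mul_sub, sub_mul, hx z hz, hy z hz]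

omit [CompleteSpace H] in
theorem smul_mem_centralizer_clm {S : Set (H →L[ℂ] H)} {x : H →L[ℂ] H} (c : ℂ)
    (hx : x ∈ Set.centralizer S) : c • x ∈ Set.centralizer S := fun y hy => by
  rw [mul_smul_comm, smul_mul_assoc, hx y hy]

/-- The von Neumann algebra generated by a `*`-closed set with a unit. -/
theorem exists_vnSubalgebra_eq_vnGenerated {S : Set (H →L[ℂ] H)} (hS : ∀ x ∈ S, star x ∈ S)
    {r : H →L[ℂ] H} (hr : r ∈ S) (hl : ∀ x ∈ S, r * x = x) (hrr : ∀ x ∈ S, x * r = x) :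
    ∃ B : VNSubalgebra H, B.toSet = vnGenerated S ∧ B.unit = r ∧
      B.toSet ⊆ Set.centralizer (Set.centralizer S) := by
  have hrs : star r = r := by
    have := congrArg star (hl _ (hS r hr))
    rw [star_mul, star_star] at this
    exact (hl _ (hS r hr)).symm.trans this
  let B : VNSubalgebra H :=
    { carrier := {x | x ∈ Set.centralizer (Set.centralizer S) ∧ r * x = x ∧ x * r = x}
      add_mem' := fun {a b} ha hb => ⟨Set.add_mem_centralizer ha.1 hb.1,
        by rw [mul_add, ha.2.1, hb.2.1], by rw [add_mul, ha.2.2, hb.2.2]⟩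
      zero_mem' := ⟨Set.zero_mem_centralizer, mul_zero _, zero_mul _⟩
      mul_mem' := fun {a b} ha hb => ⟨Set.mul_mem_centralizer ha.1 hb.1,
        by rw [← mul_assoc, ha.2.1], by rw [mul_assoc, hb.2.2]⟩
      smul_mem' := fun c x hx => ⟨smul_mem_centralizer_clm c hx.1,
        by rw [mul_smul_comm, hx.2.1], by rw [smul_mul_assoc, hx.2.2]⟩
      star_mem' := fun {a} ha => ⟨star_mem_centralizer_of_star_mem
          (fun _ h => star_mem_centralizer_of_star_mem hS h) ha.1,
        by simpa [hrs] using congrArg star ha.2.2, by simpa [hrs] using congrArg star ha.2.1⟩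
      unit := r
      unit_mem := ⟨Set.subset_centralizer_centralizer hr, hl r hr, hl r hr⟩
      unit_mul := fun _ hx => hx.2.1
      mul_unit := fun _ hx => hx.2.2
      bicommutant := fun x hx h1 h2 => ⟨by
        have : ({x | x ∈ Set.centralizer (Set.centralizer S) ∧ r * x = x ∧ x * r = x} :
          Set (H →L[ℂ] H)) ⊆ Set.centralizer (Set.centralizer S) := fun _ h => h.1
        have h3 := Set.centralizer_subset (Set.centralizer_subset this) hx
        rwa [Set.centralizer_centralizer_centralizer] at h3, h1, h2⟩ }
  refine ⟨B, Set.Subset.antisymm ?_ ?_, rfl, fun x hx => hx.1⟩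
  · intro x hx A hA
    have hrA := hA hr
    refine A.bicommutant x (Set.centralizer_subset (Set.centralizer_subset hA) hx.1) ?_ ?_
    · rw [← hx.2.1, ← mul_assoc, A.unit_mul r hrA]
    · rw [← hx.2.2, mul_assoc, A.mul_unit r hrA]
  · intro x hx
    exact hx B fun y hy => ⟨Set.subset_centralizer_centralizer hy, hl y hy, hrr y hy⟩

/-- The relative commutant is a von Neumann algebra. -/
theorem exists_vnSubalgebra_eq_relCommutant (B A : VNSubalgebra H) (hu : B.unit = A.unit) :
    ∃ R : VNSubalgebra H, R.toSet = relCommutant B.toSet A.toSet ∧ R.unit = A.unit := by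
  let R : VNSubalgebra H :=
    { carrier := relCommutant B.toSet A.toSet
      add_mem' := fun {a b} ha hb => ⟨Set.add_mem_centralizer ha.1 hb.1, A.add_mem' ha.2 hb.2⟩
      zero_mem' := ⟨Set.zero_mem_centralizer, A.zero_mem'⟩
      mul_mem' := fun {a b} ha hb => ⟨Set.mul_mem_centralizer ha.1 hb.1, A.mul_mem' ha.2 hb.2⟩
      smul_mem' := fun c x hx => ⟨smul_mem_centralizer_clm c hx.1, A.smul_mem' c hx.2⟩
      star_mem' := fun {a} ha => ⟨star_mem_centralizer_of_star_mem
        (fun x hx => B.star_mem' hx) ha.1, A.star_mem' ha.2⟩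
      unit := A.unit
      unit_mem := ⟨fun x hx => by rw [← hu, B.mul_unit x hx, B.unit_mul x hx], A.unit_mem⟩
      unit_mul := fun _ hx => A.unit_mul _ hx.2
      mul_unit := fun _ hx => A.mul_unit _ hx.2
      bicommutant := fun x hx h1 h2 => by
        refine ⟨?_, A.bicommutant x (Set.centralizer_subset
          (Set.centralizer_subset Set.inter_subset_right) hx) h1 h2⟩
        have h3 := Set.centralizer_subset (Set.centralizer_subset
          (Set.inter_subset_left : relCommutant B.toSet A.toSet ⊆ _)) hx
        rwa [Set.centralizer_centralizer_centralizer] at h3 }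
  exact ⟨R, rfl, rfl⟩

/-- The smallest projection of `A` above a projection of the commutant. -/
theorem VNSubalgebra.exists_centralSupport (A : VNSubalgebra H) {f : H →L[ℂ] H}
    (hfu : A.unit * f = f) : ∃ c ∈ A.toSet, IsStarProjection c ∧ c * f = f ∧
      ∀ x ∈ A.toSet, x * f = 0 → x * c = 0 := by
  -- c projects onto the closed span of A'fH. Invariance under A' puts c in A'', and an x in A''
  -- killing f kills every bf with b in A'.
  obtain ⟨c, hc, hc1, hc2, hc3⟩ := exists_rangeProjection
    ((fun b => b * f) '' Set.centralizer A.toSet)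
  have hcomm : ∀ b ∈ Set.centralizer A.toSet, Commute b c := by
    have key : ∀ b ∈ Set.centralizer A.toSet, ∀ T ∈ (fun b => b * f) '' Set.centralizer A.toSet,
        ∃ T' ∈ (fun b => b * f) '' Set.centralizer A.toSet, ∃ c, b * T = T' * c := by
      rintro b hb _ ⟨b', hb', rfl⟩
      exact ⟨_, ⟨b * b', Set.mul_mem_centralizer hb hb', rfl⟩, 1, by simp only [mul_assoc, mul_one]⟩
    exact fun b hb => hc3 b (key b hb)
      (key _ (star_mem_centralizer_of_star_mem (fun x hx => A.star_mem' hx) hb))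
  have hann : ∀ x ∈ Set.centralizer (Set.centralizer A.toSet), x * f = 0 → x * c = 0 := by
    intro x hx hxf
    refine hc2 x ?_
    rintro _ ⟨b, hb, rfl⟩
    show x * (b * f) = 0
    rw [← mul_assoc, ← hx b hb, mul_assoc, hxf, mul_zero]
  have huc : A.unit * c = c := by
    have h1 := hann (1 - A.unit) (sub_mem_centralizer_clm Set.one_mem_centralizer (Set.subset_centralizer_centralizer A.unit_mem))
      (by rw [sub_mul, one_mul, hfu, sub_self])
    rw [sub_mul, one_mul, sub_eq_zero] at h1
    exact h1.symm
  have hcu : c * A.unit = c := by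
    have := congrArg star huc
    rwa [star_mul, A.star_unit, hc.isSelfAdjoint.star_eq] at this
  refine ⟨c, A.bicommutant c (fun b hb => hcomm b hb) huc hcu, hc, ?_, fun x hx hxf =>
    hann x (Set.subset_centralizer_centralizer hx) hxf⟩
  exact hc1 f ⟨1, Set.one_mem_centralizer, one_mul f⟩

variable {M : VonNeumannAlgebra H} {φ : (H →L[ℂ] H) →ₗ[ℂ] ℂ}

/-- The image of a von Neumann algebra under an injective normal `*`-homomorphism is a
von Neumann algebra. -/
theorem exists_vnSubalgebra_eq_range (hφ : IsTraceOn M φ) (A : VNSubalgebra H)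
    (t : A.toNonUnitalStarSubalgebra →⋆ₙₐ[ℂ] (H →L[ℂ] H)) (htM : ∀ x, t x ∈ M)
    (hinj : Function.Injective t)
    (hweak : ∀ (U : Ultrafilter ℕ) (y : ℕ → A.toNonUnitalStarSubalgebra)
      (a : A.toNonUnitalStarSubalgebra) (b : H →L[ℂ] H), (∀ n, (y n : H →L[ℂ] H) ∈ A.posBall) →
      WeakLim U (fun n => (y n : H →L[ℂ] H)) a → WeakLim U (fun n => t (y n)) b → b = t a) :
    ∃ P₀ : VNSubalgebra H, P₀.toSet = Set.range t ∧ P₀.unit = t ⟨A.unit, A.unit_mem⟩ := by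
  let S : NonUnitalStarSubalgebra ℂ (H →L[ℂ] H) := NonUnitalStarAlgHom.range t
  have hSt : ∀ x, x ∈ S ↔ ∃ a, t a = x := fun x => Iff.rfl
  have hSM : ∀ x ∈ S, x ∈ M := by
    rintro _ ⟨a, rfl⟩; exact htM a
  let u : A.toNonUnitalStarSubalgebra := ⟨A.unit, A.unit_mem⟩
  have hul : ∀ a, u * a = a := fun a => Subtype.ext (A.unit_mul a a.2)
  have hur : ∀ a, a * u = a := fun a => Subtype.ext (A.mul_unit a a.2)
  have hus : star u = u := Subtype.ext A.star_unit
  have htu : IsStarProjection (t u) :=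
    ⟨by rw [IsIdempotentElem, ← map_mul, hul], by rw [IsSelfAdjoint, ← map_star, hus]⟩
  have hpos : ∀ a : A.toNonUnitalStarSubalgebra, 0 ≤ (a : H →L[ℂ] H) → 0 ≤ t a := by
    intro a ha
    let b : A.toNonUnitalStarSubalgebra := ⟨CFC.sqrt (a : H →L[ℂ] H), A.sqrt_mem a.2 ha⟩
    have hb : a = star b * b := by
      refine Subtype.ext ?_
      show (a : H →L[ℂ] H) = star (CFC.sqrt (a : H →L[ℂ] H)) * CFC.sqrt (a : H →L[ℂ] H)
      rw [(CFC.sqrt_nonneg (a : H →L[ℂ] H)).isSelfAdjoint.star_eq, CFC.sqrt_mul_sqrt_self _ ha]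
    rw [hb, map_mul, map_star]
    exact star_mul_self_nonneg _
  have hball : ∀ a : A.toNonUnitalStarSubalgebra, (a : H →L[ℂ] H) ∈ A.posBall →
      0 ≤ t a ∧ t a ≤ 1 := by
    intro a ha
    refine ⟨hpos a ha.2.1, ?_⟩
    -- Conjugating a ≤ 1 by the unit gives a ≤ u, so t(a) ≤ t(u) ≤ 1.
    have h1 : 0 ≤ ((u - a : A.toNonUnitalStarSubalgebra) : H →L[ℂ] H) := by
      have h2 := star_left_conjugate_le_conjugate ha.2.2 A.unit
      rw [A.star_unit, A.unit_mul _ a.2, A.mul_unit _ a.2, mul_one, A.unit_mul _ A.unit_mem] at h2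
      exact sub_nonneg.2 h2
    have h3 := hpos _ h1
    rw [map_sub, sub_nonneg] at h3
    exact h3.trans htu.le_one
  -- The image of the ball of A, rather than the ball of S, is used: compactness upstairs and
  -- `hweak` make it weakly closed before S is known to be.
  let C : Set (H →L[ℂ] H) := {x | ∃ a : A.toNonUnitalStarSubalgebra,
    (a : H →L[ℂ] H) ∈ A.posBall ∧ t a = x}
  have hcond : ∀ x ∈ M, ∃ e, IsCondExpOn φ S x e := by
    intro x hx
    refine (exists_isCondExpOn_of_contraction (S := S) (M := M) ?_ hx).1
    intro x hx h0 h1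
    obtain ⟨e, ⟨a, ha, rfl⟩, hφe⟩ := hφ.exists_condExp_of_clamp S hSM C
      (by rintro _ ⟨a, ha, rfl⟩; exact ⟨⟨a, rfl⟩, hball a ha⟩)
      ⟨0, ⟨A.zero_mem', le_rfl, zero_le_one⟩, map_zero t⟩ (by
        intro U y b hy hl
        choose z hz hzy using hy
        obtain ⟨a, ha⟩ := exists_weakLim U (fun n => (z n : H →L[ℂ] H)) 1 fun n =>
          norm_le_one_of_nonneg_of_le_one (hz n).2.1 (hz n).2.2
        have haA := A.weakLim_mem_posBall ha hz
        refine ⟨⟨a, haA.1⟩, haA, (hweak U z ⟨a, haA.1⟩ b hz ha ?_).symm⟩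
        have : (fun n => t (z n)) = y := funext hzy
        rwa [this]) (by
        rintro _ ⟨a, rfl⟩ hsa
        have hsa' : IsSelfAdjoint a := hinj (by
          show t (star a) = t a
          rw [map_star]; exact hsa.star_eq)
        obtain ⟨c, hc, d₁, hd₁, d₂, hd₂, h1, h2, h3, h4, h5, h6, h7⟩ :=
          A.exists_clamp a.2 (congrArg Subtype.val hsa'.star_eq)
        let c' : A.toNonUnitalStarSubalgebra := ⟨c, hc⟩
        let d₁' : A.toNonUnitalStarSubalgebra := ⟨d₁, hd₁⟩
        let d₂' : A.toNonUnitalStarSubalgebra := ⟨d₂, hd₂⟩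
        refine ⟨t c', ⟨c', ⟨hc, h1, h2⟩, rfl⟩, t d₁', ⟨d₁', rfl⟩, t d₂', ⟨d₂', rfl⟩,
          hpos d₁' h3, hpos d₂' h4, ?_, ?_, ?_⟩
        · rw [← map_add, ← map_sub]
          exact congrArg t (Subtype.ext h5)
        · rw [← map_mul]
          exact congrArg t (Subtype.ext h6)
        · rw [← map_mul, ← map_zero t]
          exact congrArg t (Subtype.ext h7)) hx h0 h1
    exact ⟨t a, (hball a ha).1, ⟨a, rfl⟩, hφe⟩
  have htul : ∀ x ∈ S, t u * x = x := by
    rintro _ ⟨a, rfl⟩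
    exact (map_mul t u a).symm.trans (congrArg t (hul a))
  have htur : ∀ x ∈ S, x * t u = x := by
    rintro _ ⟨a, rfl⟩
    exact (map_mul t a u).symm.trans (congrArg t (hur a))
  -- With e the expectation of x, the functional y ↦ φ((x − e)y) kills S, hence by density kills (x
  -- − e)*; faithfulness gives x = e.
  have hbic : ∀ x ∈ Set.centralizer (Set.centralizer (S : Set (H →L[ℂ] H))),
      t u * x = x → x * t u = x → x ∈ S := by
    intro x hx hxl hxr
    have hxM : x ∈ M := by
      have h1 := Set.centralizer_subset (Set.centralizer_subset
        (fun y hy => hSM y hy : (S : Set (H →L[ℂ] H)) ⊆ (M : Set (H →L[ℂ] H)))) hx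
      rwa [M.centralizer_centralizer] at h1
    obtain ⟨e, he, hφe⟩ := hcond x hxM
    have heM := hSM e he
    have hd : star (x - e) ∈ Set.centralizer (Set.centralizer (S : Set (H →L[ℂ] H))) := by
      refine star_mem_centralizer_of_star_mem (fun _ h =>
        star_mem_centralizer_of_star_mem (fun y hy => star_mem (s := S) hy) h) ?_
      exact sub_mem_centralizer_clm hx (Set.subset_centralizer_centralizer he)
    have hdu : star (x - e) * t u = star (x - e) := by
      have : t u * (x - e) = x - e := by rw [mul_sub, hxl, htul e he]
      have h1 := congrArg star this
      rwa [star_mul, htu.isSelfAdjoint.star_eq] at h1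
    have h0 := (hφ.normal.compress (x - e) 1).eq_zero_of_mem_bicommutant S
      (e := t u) ⟨u, rfl⟩ (fun y hy => by
        show φ ((x - e) * y * 1) = 0
        rw [mul_one, sub_mul, map_sub, hφe y hy, sub_self]) hd hdu
    have h1 : φ ((x - e) * star (x - e) * 1) = 0 := h0
    have h2 := hφ.faithful (star (x - e)) (star_mem (sub_mem hxM heM)) (by
      rwa [star_star, ← mul_one ((x - e) * star (x - e))])
    rw [star_eq_zero, sub_eq_zero] at h2
    exact h2 ▸ he
  exact ⟨{ S with
    unit := t u
    unit_mem := ⟨u, rfl⟩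
    unit_mul := htul
    mul_unit := htur
    bicommutant := hbic }, rfl, rfl⟩

end Constructions

/-! ### Upper and lower 2-norm bounds for the compression x ↦ w*xw. -/

section IndexEstimates

variable {H : Type*} [NormedAddCommGroup H] [InnerProductSpace ℂ H] [CompleteSpace H]
  {M : VonNeumannAlgebra H} {φ : (H →L[ℂ] H) →ₗ[ℂ] ℂ} (hφ : IsTraceOn M φ)

include hφ

theorem IsTraceOn.map_re_mono {x y : H →L[ℂ] H} (hx : x ∈ M) (hy : y ∈ M) (h : x ≤ y) :
    (φ x).re ≤ (φ y).re := by
  have := (Complex.nonneg_iff.1 (hφ.map_nonneg (sub_mem hy hx) (sub_nonneg.2 h))).1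
  rw [map_sub, Complex.sub_re] at this
  linarith

/-- Compression by a contraction does not increase the `2`-norm. -/
theorem IsTraceOn.sqNormTwo_conjugate_le {w b : H →L[ℂ] H} (hw : w ∈ M) (hb : b ∈ M)
    (hw1 : w * star w ≤ 1) : sqNormTwo φ (star w * b * w) ≤ sqNormTwo φ b := by
  have hsw := star_mem (s := M) hw
  have hsb := star_mem (s := M) hb
  have h1 : star (star w * b * w) * (star w * b * w)
      = star w * (star b * (w * star w) * b) * w := by
    simp only [star_mul, star_star, mul_assoc]
  have h2 : star w * (star b * (w * star w) * b) * w ≤ star w * (star b * b) * w := by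
    refine star_left_conjugate_le_conjugate ?_ w
    have := star_left_conjugate_le_conjugate hw1 b
    rwa [mul_one] at this
  have h3 : φ (star w * (star b * b) * w) = φ (b * (w * star w) * star b) := by
    rw [mul_assoc (star w), hφ.trace _ hsw _ (mul_mem (mul_mem hsb hb) hw)]
    rw [mul_assoc (star b), mul_assoc (star b), hφ.trace _ hsb _ (mul_mem (mul_mem hb hw) hsw)]
    simp only [mul_assoc]
  have h4 : b * (w * star w) * star b ≤ b * star b := by
    have := star_left_conjugate_le_conjugate hw1 (star b)
    rwa [mul_one, star_star] at this
  have h5 := hφ.map_re_mono (mul_mem (mul_mem hsw (mul_mem (mul_mem hsb (mul_mem hw hsw)) hb)) hw)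
    (mul_mem (mul_mem hsw (mul_mem hsb hb)) hw) h2
  have h6 := hφ.map_re_mono (mul_mem (mul_mem hb (mul_mem hw hsw)) hsb) (mul_mem hb hsb) h4
  rw [sqNormTwo, h1]
  rw [h3] at h5
  rw [sqNormTwo, hφ.trace _ hsb _ hb]
  exact h5.trans h6

/-- If `E(w w*) ≥ s r`, then `x ↦ w* x w` is bounded below on the positive part of the corner. -/
theorem IsTraceOn.sqNormTwo_conjugate_ge {S : Set (H →L[ℂ] H)} {w x e r : H →L[ℂ] H} {s : ℝ}
    (hs : 0 ≤ s) (hSM : ∀ y ∈ S, y ∈ M) (hw : w ∈ M) (he : IsCondExpOn φ S (w * star w) e)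
    (hr : r ∈ M) (hle : (s : ℂ) • r ≤ e) (hx : x ∈ M) (hx0 : 0 ≤ x) (hxx : x * x ∈ S)
    (hrx : r * x = x) : s ^ 2 * sqNormTwo φ x ≤ sqNormTwo φ (star w * x * w) := by
  have hxs : star x = x := hx0.isSelfAdjoint.star_eq
  set h := CFC.sqrt x with hh
  have hhM : h ∈ M := M.sqrt_mem hx hx0
  have hhs : star h = h := (CFC.sqrt_nonneg x).isSelfAdjoint.star_eq
  have hhh : h * h = x := CFC.sqrt_mul_sqrt_self x hx0
  have hws := star_mem (s := M) hw
  have heM := hSM e he.1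
  -- k has the 2-norm of w*xw, both squares having trace φ(ww*xww*x). It is better suited to pairing
  -- with x: φ(kx) = φ(ww*x²) = φ(ex²) ≥ s‖x‖₂², and Cauchy–Schwarz finishes.
  set k := h * (w * star w) * h with hk
  have hkM : k ∈ M := mul_mem (mul_mem hhM (mul_mem hw hws)) hhM
  have hks : star k = k := by simp only [hk, star_mul, star_star, hhs, mul_assoc]
  have hxn : φ (x * x) = (sqNormTwo φ x : ℂ) := by
    have := hφ.map_star_mul_self hx
    rwa [hxs] at this
  have h1 : φ (star k * x) = φ (w * star w * (x * x)) := by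
    rw [hks, hk, mul_assoc, mul_assoc h, hφ.trace _ hhM _
      (mul_mem (mul_mem hw hws) (mul_mem hhM hx)), mul_assoc (w * star w)]
    congr 2
    rw [← hhh]; simp only [mul_assoc]
  have h2 : s * sqNormTwo φ x ≤ (φ (star k * x)).re := by
    rw [h1, ← he.2 _ hxx]
    have h3 := (Complex.nonneg_iff.1 (hφ.map_nonneg (mul_mem (mul_mem hx
      (sub_mem heM (M.smul_mem s hr))) hx) (by
        have := star_left_conjugate_nonneg (sub_nonneg.2 hle) x
        rwa [hxs] at this))).1
    rw [mul_assoc, hφ.trace _ hx _ (mul_mem (sub_mem heM (M.smul_mem s hr)) hx), mul_assoc,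
      sub_mul, smul_mul_assoc, ← mul_assoc r, hrx, map_sub, map_smul, hxn, Complex.sub_re,
      smul_eq_mul, ← Complex.ofReal_mul, Complex.ofReal_re] at h3
    linarith
  have h3 : sqNormTwo φ k = sqNormTwo φ (star w * x * w) := by
    rw [sqNormTwo, sqNormTwo, hks]
    congr 1
    have h4 : k * k = h * (w * star w * x * (w * star w) * h) := by
      rw [hk, ← hhh]; simp only [mul_assoc]
    have h5 : star (star w * x * w) * (star w * x * w)
        = star w * (x * (w * star w) * x * w) := by
      simp only [star_mul, star_star, hxs, mul_assoc]
    rw [h4, h5, hφ.trace _ hhM _ (mul_mem (mul_mem (mul_mem (mul_mem hw hws) hx)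
      (mul_mem hw hws)) hhM), hφ.trace _ hws _ (mul_mem (mul_mem (mul_mem hx (mul_mem hw hws)) hx)
      hw), mul_assoc _ h h, hhh, mul_assoc (w * star w * x),
      hφ.trace _ (mul_mem (mul_mem hw hws) hx) _ (mul_mem (mul_mem hw hws) hx)]
    rw [mul_assoc (w * star w) x, hφ.trace _ (mul_mem hw hws) _
      (mul_mem hx (mul_mem (mul_mem hw hws) hx))]
    simp only [mul_assoc]
  have h4 := hφ.norm_map_star_mul_le hkM hx
  have h5 := h2.trans ((Complex.re_le_norm _).trans h4)
  rw [h3] at h5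
  have hn0 := hφ.sqNormTwo_nonneg hx
  have hsq := Real.mul_self_sqrt hn0
  rcases hn0.eq_or_lt with h0 | h0
  · rw [← h0, mul_zero]
    exact hφ.sqNormTwo_nonneg (mul_mem (mul_mem hws hx) hw)
  · have hpos := Real.sqrt_pos.2 h0
    have h6 : s * √(sqNormTwo φ x) ≤ √(sqNormTwo φ (star w * x * w)) := by
      refine le_of_mul_le_mul_right ?_ hpos
      calc s * √(sqNormTwo φ x) * √(sqNormTwo φ x) = s * sqNormTwo φ x := by
            rw [mul_assoc, hsq]
        _ ≤ _ := h5
    have h7 := pow_le_pow_left₀ (mul_nonneg hs hpos.le) h6 2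
    rwa [mul_pow, Real.sq_sqrt hn0, Real.sq_sqrt
      (hφ.sqNormTwo_nonneg (mul_mem (mul_mem hws hx) hw))] at h7

/-- Comparison of the conditional expectations of `w* x w` and of `x`. -/
theorem IsTraceOn.sqNormTwo_condExp_le {Q : NonUnitalStarSubalgebra ℂ (H →L[ℂ] H)}
    {w x e b : H →L[ℂ] H} (hQM : ∀ y ∈ Q, y ∈ M) (hw : w ∈ M) (hw1 : w * star w ≤ 1)
    (hx : x ∈ M) (hb : b ∈ M) (he : IsCondExpOn φ Q (star w * x * w) e)
    (horth : ∀ a ∈ Q, φ (a * (star w * (x - b) * w)) = 0) : sqNormTwo φ e ≤ sqNormTwo φ b := by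
  have heM := hQM e he.1
  have hws := star_mem (s := M) hw
  have hseQ : star e ∈ Q := star_mem he.1
  have hcM : star w * b * w ∈ M := mul_mem (mul_mem hws hb) hw
  -- Orthogonality replaces x by b, so e is also the expectation of w*bw as far as pairing with e is
  -- concerned.
  have h1 : φ (star e * e) = φ (star e * (star w * b * w)) := by
    rw [hφ.trace _ (star_mem heM) _ heM, he.2 _ hseQ,
      hφ.trace _ (mul_mem (mul_mem hws hx) hw) _ (star_mem heM), ← sub_eq_zero, ← map_sub,
      ← mul_sub, ← sub_mul, ← mul_sub]
    exact horth _ hseQ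
  have h2 := hφ.norm_map_star_mul_le heM hcM
  rw [← h1, hφ.map_star_mul_self heM, Complex.norm_real,
    Real.norm_of_nonneg (hφ.sqNormTwo_nonneg heM)] at h2
  have h3 := hφ.sqNormTwo_conjugate_le hw hb hw1
  have hn := hφ.sqNormTwo_nonneg heM
  have hs := Real.mul_self_sqrt hn
  refine le_trans ?_ h3
  have hc := hφ.sqNormTwo_nonneg hcM
  have hsc := Real.mul_self_sqrt hc
  have h4 : √(sqNormTwo φ e) ≤ √(sqNormTwo φ (star w * b * w)) := by
    by_contra hlt
    push Not at hlt
    have hpos := (Real.sqrt_nonneg _).trans_lt hlt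
    nlinarith
  exact (Real.sqrt_le_sqrt_iff hc).1 h4

end IndexEstimates

/-! ### From traces on M to functionals on B(H). -/

section Bridge

variable {H : Type*} [NormedAddCommGroup H] [InnerProductSpace ℂ H] [CompleteSpace H]
  {M : VonNeumannAlgebra H} {τ : M.toStarSubalgebra →ₗ[ℂ] ℂ} {φ : (H →L[ℂ] H) →ₗ[ℂ] ℂ}

/-- The series expressing normality makes sense on all of B(H). With this extension the arguments
run on plain operators instead of elements of a subtype. -/
theorem IsFaithfulNormalTracialState.exists_isTraceOn (hτ : IsFaithfulNormalTracialState M τ) :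
    ∃ φ : (H →L[ℂ] H) →ₗ[ℂ] ℂ, IsTraceOn M φ ∧
      ∀ x : M.toStarSubalgebra, φ (x : H →L[ℂ] H) = τ x := by
  obtain ⟨ξ, η, hξ, hη, hs⟩ := hτ.normal
  obtain ⟨φ, hφ, hφs⟩ := exists_isNormalFunctional hξ hη
  have heq : ∀ x : M.toStarSubalgebra, φ (x : H →L[ℂ] H) = τ x := fun x =>
    (hφs _).unique (hs x)
  refine ⟨φ, ⟨hφ, fun x hx => ?_, fun x hx h0 => ?_, fun x hx y hy => ?_⟩, heq⟩
  · have h1 := heq (star ⟨x, hx⟩ * ⟨x, hx⟩)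
    have h2 := hτ.nonneg ⟨x, hx⟩
    rw [← h1] at h2
    exact h2
  · have h1 := heq (star ⟨x, hx⟩ * ⟨x, hx⟩)
    exact congrArg Subtype.val (hτ.faithful ⟨x, hx⟩ (h1.symm.trans h0))
  · have h1 := heq (⟨x, hx⟩ * ⟨y, hy⟩)
    have h2 := heq (⟨y, hy⟩ * ⟨x, hx⟩)
    rw [hτ.trace, ← h2] at h1
    exact h1

variable (heq : ∀ x : M.toStarSubalgebra, φ (x : H →L[ℂ] H) = τ x)

include heq

theorem traceNorm_sq (hφ : IsTraceOn M φ) (x : M.toStarSubalgebra) :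
    traceNorm τ x ^ 2 = sqNormTwo φ x := by
  have h1 : (τ (star x * x)).re = sqNormTwo φ x := by rw [← heq]; rfl
  rw [traceNorm, h1, Real.sq_sqrt (hφ.sqNormTwo_nonneg x.2)]

theorem coe_condExp_eq (hφ : IsTraceOn M φ) (S : NonUnitalStarSubalgebra ℂ (H →L[ℂ] H))
    (hSM : ∀ y ∈ S, y ∈ M) (x : M.toStarSubalgebra) {e : H →L[ℂ] H}
    (he : IsCondExpOn φ S (x : H →L[ℂ] H) e) :
    (condExp τ (S : Set (H →L[ℂ] H)) x : H →L[ℂ] H) = e := by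
  have hex : ∃ e', IsCondExp τ (S : Set (H →L[ℂ] H)) x e' :=
    ⟨⟨e, hSM e he.1⟩, he.1, fun y hy => by
      rw [← heq, ← heq]; exact he.2 y hy⟩
  have hdef : condExp τ (S : Set (H →L[ℂ] H)) x = hex.choose := dif_pos hex
  rw [hdef]
  refine IsCondExpOn.unique (S := S) hφ hSM ⟨hex.choose_spec.1, fun y hy => ?_⟩ he
  have h1 := hex.choose_spec.2 ⟨y, hSM y hy⟩ hy
  rw [← heq, ← heq] at h1
  exact h1

end Bridge

/-! ### Improving the embedding to an injective unital intertwiner. -/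

section Intertwiner

variable {H : Type*} [NormedAddCommGroup H] [InnerProductSpace ℂ H] [CompleteSpace H]
  {M N : VonNeumannAlgebra H} {φ : (H →L[ℂ] H) →ₗ[ℂ] ℂ}

/-- 0 ≤ s·XrX* ≤ XeX* = 0, and XrX* = (Xr)(Xr)*. -/
theorem mul_eq_zero_of_smul_le {e r X : H →L[ℂ] H} {s : ℝ} (hs : 0 < s)
    (hr : IsStarProjection r) (hle : (s : ℂ) • r ≤ e) (hX : X * e = 0) : X * r = 0 := by
  have h1 := star_left_conjugate_le_conjugate hle (star X)
  rw [star_star, hX, zero_mul, mul_smul_comm, smul_mul_assoc] at h1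
  have h2 : X * r * star X = (X * r) * star (X * r) := by
    rw [star_mul, hr.isSelfAdjoint.star_eq, mul_assoc X r (r * star X), ← mul_assoc r r,
      hr.isIdempotentElem.eq, mul_assoc]
  have h3 : 0 ≤ X * r * star X := h2 ▸ mul_star_self_nonneg _
  have h4 : (0 : ℂ) ≤ (s : ℂ)⁻¹ := by
    rw [← Complex.ofReal_inv]; exact_mod_cast (inv_pos.2 hs).le
  have h5 : X * r * star X ≤ 0 := by
    have := smul_le_smul_of_nonneg_left h1 h4
    rwa [inv_smul_smul₀ (by exact_mod_cast hs.ne'), smul_zero] at this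
  have h6 : (X * r) * star (X * r) = 0 := h2 ▸ le_antisymm h5 h3
  exact CStarRing.mul_star_self_eq_zero_iff _ |>.1 h6

/-- An element of `N` that annihilates an element with conditional expectation bounded below on
`r` annihilates `r`. -/
theorem IsCondExpOn.mul_eq_zero (hφ : IsTraceOn M φ) (hNM : ∀ y ∈ N, y ∈ M)
    {x e r X : H →L[ℂ] H} {s : ℝ} (hs : 0 < s) (hr : IsStarProjection r) (hx : x ∈ M)
    (he : IsCondExpOn φ (N : Set (H →L[ℂ] H)) x e) (hle : (s : ℂ) • r ≤ e * r ∨ (s : ℂ) • r ≤ e)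
    (hX : X ∈ N) (hXx : X * x = 0) : X * r = 0 := by
  let S := (VNSubalgebra.ofVonNeumannAlgebra N).toNonUnitalStarSubalgebra
  -- Bimodularity turns Xx = 0 into Xe = 0.
  have h1 : IsCondExpOn φ S (X * x) (X * e) := IsCondExpOn.mul_left (S := S) hφ hNM he hx hX
  have h2 : IsCondExpOn φ S (X * x) 0 := by
    rw [hXx]; exact ⟨zero_mem S, fun _ _ => rfl⟩
  have h3 : X * e = 0 := IsCondExpOn.unique (S := S) hφ hNM h1 h2
  rcases hle with hle | hle
  · exact mul_eq_zero_of_smul_le hs hr hle (by rw [← mul_assoc, h3, zero_mul])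
  · exact mul_eq_zero_of_smul_le hs hr hle h3

/-- The `*`-homomorphism `x ↦ θ(x) r` on a subalgebra, for a projection `r` commuting with the
range of `θ`. -/
noncomputable def restrictCompress {A B C : NonUnitalStarSubalgebra ℂ (H →L[ℂ] H)} (θ : A →⋆ₙₐ[ℂ] B)
    {r : H →L[ℂ] H} (hr : IsStarProjection r) (hθr : ∀ x, Commute (θ x : H →L[ℂ] H) r)
    (hCA : ∀ x ∈ C, x ∈ A) : C →⋆ₙₐ[ℂ] (H →L[ℂ] H) where
  toFun x := (θ ⟨x, hCA x x.2⟩ : H →L[ℂ] H) * r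
  map_smul' k x := by
    have h : (⟨_, hCA _ (k • x).2⟩ : A) = k • ⟨x, hCA x x.2⟩ := rfl
    rw [h, map_smul]
    exact smul_mul_assoc k _ r
  map_zero' := by
    have h : (⟨_, hCA _ (0 : C).2⟩ : A) = 0 := rfl
    rw [h, map_zero]
    exact zero_mul r
  map_add' x y := by
    have h : (⟨_, hCA _ (x + y).2⟩ : A) = ⟨x, hCA x x.2⟩ + ⟨y, hCA y y.2⟩ := rfl
    rw [h, map_add]
    exact add_mul _ _ r
  map_mul' x y := by
    have h : (⟨_, hCA _ (x * y).2⟩ : A) = ⟨x, hCA x x.2⟩ * ⟨y, hCA y y.2⟩ := rfl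
    have h2 := (hθr ⟨y, hCA y y.2⟩).eq
    rw [h, map_mul]
    show ((θ ⟨x, hCA x x.2⟩ : H →L[ℂ] H) * θ ⟨y, hCA y y.2⟩) * r = _
    rw [mul_assoc _ r, ← mul_assoc r, ← h2, mul_assoc _ r r, hr.isIdempotentElem.eq, mul_assoc]
  map_star' x := by
    have h : (⟨_, hCA _ (star x).2⟩ : A) = star ⟨x, hCA x x.2⟩ := rfl
    rw [h, star_mul, hr.isSelfAdjoint.star_eq]
    have h1 := (hθr (star ⟨x, hCA x x.2⟩)).eq
    rw [map_star] at h1 ⊢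
    exact h1

/-- Improvement of an embedding of a corner: the `*`-homomorphism is injective and unital, the
range projection of the partial isometry lies under `r`, and its expectation is bounded below. -/
theorem CornerEmbeds.exists_intertwiner (hφ : IsTraceOn M φ) (hNM : ∀ y ∈ N, y ∈ M)
    {P : VNSubalgebra H}
    (hPN : CornerEmbeds M P (VNSubalgebra.ofVonNeumannAlgebra N)) :
    ∃ (s : ℝ) (r w e c : H →L[ℂ] H) (hc : IsStarProjection c) (hcP : c ∈ P.toSet)
      (t : (P.corner c hc hcP).toNonUnitalStarSubalgebra →⋆ₙₐ[ℂ] (H →L[ℂ] H)),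
      0 < s ∧ IsStarProjection r ∧ r ∈ N ∧ r ≠ 0 ∧ c ≠ 0 ∧ w ∈ M ∧ IsPartialIsometry w ∧
      r * w = w ∧ w * c = w ∧ (∀ x, t x ∈ N) ∧
      t ⟨c, (P.corner c hc hcP).unit_mem⟩ = r ∧ Function.Injective t ∧
      (∀ x, t x * w = w * (x : H →L[ℂ] H)) ∧
      IsCondExpOn φ (N : Set (H →L[ℂ] H)) (w * star w) e ∧ (s : ℂ) • r ≤ e := by
  obtain ⟨p, hp, hpP, q, hq, hqN, θ, v, hp0, hq0, hvM, hv0, hvp, hqv, hvp', hθ⟩ := hPN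
  let S := (VNSubalgebra.ofVonNeumannAlgebra N).toNonUnitalStarSubalgebra
  have hvs := star_mem (s := M) hvM
  have hvvM : v * star v ∈ M := mul_mem hvM hvs
  obtain ⟨E, hE0, hE⟩ := ((VNSubalgebra.ofVonNeumannAlgebra N).exists_isCondExpOn hφ hNM hvvM).2
    (mul_star_self_nonneg v)
  have hEne : E ≠ 0 := by
    rintro rfl
    have h1 := hE.2 1 (one_mem N)
    rw [zero_mul, map_zero, mul_one] at h1
    have h2 := hφ.faithful (star v) hvs (by rw [star_star]; exact h1.symm)
    exact hv0 (star_eq_zero.1 h2)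
  obtain ⟨s, r, hs, hr, hr0, hrc, hrE⟩ := exists_spectralProjection hE0 hEne
  have hrs := hr.isSelfAdjoint.star_eq
  have hrr := hr.isIdempotentElem.eq
  have hrN : r ∈ N := by
    have h1 : r ∈ Set.centralizer (Set.centralizer (N : Set (H →L[ℂ] H))) := fun b hb =>
      (hrc b (hb E hE.1).symm).eq
    rwa [N.centralizer_centralizer] at h1
  have hrM := hNM r hrN
  have hθN : ∀ x, (θ x : H →L[ℂ] H) ∈ N := fun x => (θ x).2.1
  have hθs : ∀ x, star (θ x : H →L[ℂ] H) = (θ (star x) : H →L[ℂ] H) := fun x => by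
    rw [map_star]; rfl
  have hθv : ∀ x, Commute (θ x : H →L[ℂ] H) (v * star v) := by
    intro x
    have h1 : (θ x : H →L[ℂ] H) * (v * star v) = v * x * star v := by rw [← mul_assoc, hθ]
    have h2 : (θ (star x) : H →L[ℂ] H) * (v * star v) = v * star (x : H →L[ℂ] H) * star v := by
      rw [← mul_assoc, hθ]; rfl
    have h3 := congrArg star h2
    rw [← hθs] at h3
    simp only [star_mul, star_star] at h3
    exact h1.trans (by rw [mul_assoc v, h3])
  have hθE : ∀ x, Commute (θ x : H →L[ℂ] H) E := by
    intro x
    have h1 := IsCondExpOn.mul_left (S := S) hφ hNM hE hvvM (hθN x)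
    have h2 := IsCondExpOn.mul_right (S := S) hE (hθN x)
    rw [(hθv x).eq] at h1
    exact IsCondExpOn.unique (S := S) hφ hNM h1 h2
  have hθr : ∀ x, Commute (θ x : H →L[ℂ] H) r := fun x => hrc _ (hθE x)
  let A := P.corner p hp hpP
  let p' : A.toNonUnitalStarSubalgebra := ⟨p, A.unit_mem⟩
  -- θ(p) need not be the unit of the target corner, but 1 − θ(p) kills vv*, hence kills r.
  have hθp : (θ p' : H →L[ℂ] H) * r = r := by
    have h1 := IsCondExpOn.mul_eq_zero hφ hNM hs hr hvvM hE (Or.inl hrE)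
      (sub_mem (one_mem N) (hθN p')) (by
        rw [sub_mul, one_mul, ← mul_assoc, hθ]
        show v * star v - v * p * star v = 0
        rw [hvp', sub_self])
    rw [sub_mul, one_mul, sub_eq_zero] at h1
    exact h1.symm
  -- Cutting by r keeps the intertwining relation but destroys the partial isometry; the polar part
  -- of T restores it.
  set T := r * v with hT
  have hTM : T ∈ M := mul_mem hrM hvM
  have hθT : ∀ x, (θ x : H →L[ℂ] H) * T = T * (x : H →L[ℂ] H) := fun x => by
    rw [hT, ← mul_assoc, (hθr x).eq, mul_assoc, hθ, mul_assoc]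
  have hcomm_aux : ∀ (X : H →L[ℂ] H), (∀ x, (θ x : H →L[ℂ] H) * X = X * (x : H →L[ℂ] H)) →
      ∀ x : A.toNonUnitalStarSubalgebra, Commute (x : H →L[ℂ] H) (star X * X) := by
    intro X hX x
    have h1 := congrArg star (hX (star x))
    rw [star_mul, star_mul, ← hθs] at h1
    have h2 : star X * (θ x : H →L[ℂ] H) = (x : H →L[ℂ] H) * star X := by
      simpa using h1
    show (x : H →L[ℂ] H) * (star X * X) = star X * X * (x : H →L[ℂ] H)
    rw [← mul_assoc, ← h2, mul_assoc, hX, mul_assoc]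
  have hxTT := hcomm_aux T hθT
  obtain ⟨w, hwa, hwp, hww, hwint⟩ := exists_polarDecomposition T
  have hrw : r * w = w := by
    have := hwint r 1 (by rw [hT, ← mul_assoc, hrr, mul_one]) (Commute.one_left _)
    rwa [mul_one] at this
  have hθw : ∀ x, (θ x : H →L[ℂ] H) * w = w * (x : H →L[ℂ] H) := fun x =>
    hwint _ _ (hθT x) (hxTT x)
  have hwp' : w * p = w := by
    have := hwint 1 p (by rw [one_mul, hT, mul_assoc, hvp']) (hxTT p')
    rw [one_mul] at this
    exact this.symm
  have hwM : w ∈ M := by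
    have h1 : w ∈ Set.centralizer (Set.centralizer (M : Set (H →L[ℂ] H))) := fun b hb => by
      have h2 := hb T hTM
      have h3 := hb _ (mul_mem (star_mem hTM) hTM)
      exact hwint b b h2.symm h3.symm
    rwa [M.centralizer_centralizer] at h1
  have hws := star_mem (s := M) hwM
  have hwwM : w * star w ∈ M := mul_mem hwM hws
  have hvv1 : star v * v ≤ 1 := by
    have : IsStarProjection (star v * v) :=
      ⟨by rw [IsIdempotentElem, mul_assoc, ← mul_assoc v, hvp],
        IsSelfAdjoint.star_mul_self v⟩
    exact this.le_one
  have hTT1 : star T * T ≤ 1 := by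
    have h1 := star_left_conjugate_le_conjugate hr.le_one v
    rw [mul_one] at h1
    have h2 : star T * T = star v * r * v := by
      rw [hT, star_mul, hrs, mul_assoc, ← mul_assoc r, hrr, mul_assoc]
    exact h2 ▸ h1.trans hvv1
  -- TT* = w(T*T)w* and T is a contraction, so passing from T to w only enlarges the expectation.
  have hTTw : T * star T ≤ w * star w := by
    have h1 := star_left_conjugate_le_conjugate hTT1 (star w)
    rw [star_star, mul_one] at h1
    have h2 : T * star T = w * (star T * T) * star w := by
      have ha := CFC.sqrt_mul_sqrt_self (star T * T) (star_mul_self_nonneg T)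
      calc T * star T = (w * CFC.sqrt (star T * T)) * star (w * CFC.sqrt (star T * T)) := by
            rw [hwa]
        _ = w * (CFC.sqrt (star T * T) * CFC.sqrt (star T * T)) * star w := by
            rw [star_mul w, (CFC.sqrt_nonneg (star T * T)).isSelfAdjoint.star_eq]
            simp only [mul_assoc]
        _ = w * (star T * T) * star w := by rw [ha]
    exact h2 ▸ h1
  obtain ⟨⟨e, he⟩, -⟩ := (VNSubalgebra.ofVonNeumannAlgebra N).exists_isCondExpOn hφ hNM hwwM
  have hse : (s : ℂ) • r ≤ e := by
    have h1 : IsCondExpOn φ S (T * star T) (r * E * r) := by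
      have h2 := IsCondExpOn.mul_right (S := S)
        (IsCondExpOn.mul_left (S := S) hφ hNM hE hvvM hrN) hrN
      have h3 : T * star T = r * (v * star v) * r := by
        rw [hT, star_mul, hrs]; simp only [mul_assoc]
      rwa [h3]
    have h4 := IsCondExpOn.nonneg (A := VNSubalgebra.ofVonNeumannAlgebra N) hφ hNM
      (IsCondExpOn.sub (S := S) he h1) (sub_mem hwwM (mul_mem hTM (star_mem hTM)))
      (sub_nonneg.2 hTTw)
    have h5 : r * E * r = E * r := by
      rw [← (hrc E (Commute.refl E)).eq, mul_assoc, hrr]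
    rw [h5] at h4
    exact hrE.trans (sub_nonneg.1 h4)
  have hpf : p * (star w * w) = star w * w := by
    have := congrArg star hwp'
    rw [star_mul, hp.isSelfAdjoint.star_eq] at this
    rw [← mul_assoc, this]
  -- Cutting p to c secures injectivity: t(x) = 0 gives wx = 0, hence xw*w = 0 and x = xc = 0.
  obtain ⟨c, hcA, hc, hcf, hcz⟩ := A.exists_centralSupport (f := star w * w) hpf
  have hcP : c ∈ P.toSet := hcA.1
  have hpc : p * c = c := hcA.2.1
  have hcp : c * p = c := hcA.2.2
  have hwc : w * c = w := by
    have h1 := congrArg star hcf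
    rw [star_mul, hc.isSelfAdjoint.star_eq, hwp.isSelfAdjoint.star_eq] at h1
    rw [← hww, mul_assoc, h1]
  have hT0 : T ≠ 0 := by
    intro h0
    have h1 := IsCondExpOn.mul_eq_zero hφ hNM hs hr hvvM hE (Or.inl hrE) hrN (by
      rw [← mul_assoc, ← hT, h0, zero_mul])
    exact hr0 (hrr ▸ h1)
  have hw0 : w ≠ 0 := by
    rintro rfl
    exact hT0 (by rw [← hwa, zero_mul])
  have hc0 : c ≠ 0 := by
    rintro rfl
    exact hw0 (by rw [← hwc, mul_zero])
  have hcor : ∀ x, x ∈ (P.corner c hc hcP).toNonUnitalStarSubalgebra →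
      x ∈ A.toNonUnitalStarSubalgebra := fun x hx =>
    ⟨hx.1, by rw [← hx.2.1, ← mul_assoc, hpc], by rw [← hx.2.2, mul_assoc, hcp]⟩
  let ι : (P.corner c hc hcP).toNonUnitalStarSubalgebra → A.toNonUnitalStarSubalgebra :=
    fun x => ⟨x, hcor x x.2⟩
  let t := restrictCompress θ hr hθr hcor
  have ht : ∀ x, t x = (θ (ι x) : H →L[ℂ] H) * r := fun x => rfl
  have htw : ∀ x, t x * w = w * (x : H →L[ℂ] H) := fun x => by
    rw [ht, mul_assoc, hrw, hθw]
  refine ⟨s, r, w, e, c, hc, hcP, t, hs, hr, hrN, hr0, hc0, hwM, ?_, hrw, hwc,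
    fun x => mul_mem (hθN _) hrN, ?_, ?_, htw, he, hse⟩
  · rw [IsPartialIsometry, mul_assoc, hww]
  -- w(p − c) = 0, so θ(p − c) kills ww*, hence r; thus θ(c)r = θ(p)r = r.
  · let c' : A.toNonUnitalStarSubalgebra := ⟨c, hcA⟩
    have h1 := IsCondExpOn.mul_eq_zero hφ hNM hs hr hwwM he (Or.inr hse)
      (hθN (p' - c')) (by
        rw [← mul_assoc, hθw]
        show w * (p - c) * star w = 0
        rw [mul_sub, hwp', hwc, sub_self, zero_mul])
    rw [map_sub] at h1
    have h2 : ((θ p' : H →L[ℂ] H) - θ c') * r = 0 := h1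
    rw [sub_mul, hθp, sub_eq_zero] at h2
    exact h2.symm
  · rw [injective_iff_map_eq_zero]
    intro x hx
    have h1 : w * (x : H →L[ℂ] H) = 0 := by rw [← htw, hx, zero_mul]
    have h2 : (x : H →L[ℂ] H) * (star w * w) = 0 := by
      have := (hcomm_aux w hθw (ι x)).eq
      exact this.trans (by rw [mul_assoc]; exact (congrArg _ h1).trans (mul_zero _))
    have h3 := hcz x (hcor x x.2) h2
    exact Subtype.ext (x.2.2.2.symm.trans h3)

/-- The homomorphism of an intertwiner is continuous along bounded weak limits. -/
theorem eq_of_weakLim_of_intertwines (hφ : IsTraceOn M φ) (hNM : ∀ y ∈ N, y ∈ M)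
    {A : VNSubalgebra H} {t : A.toNonUnitalStarSubalgebra →⋆ₙₐ[ℂ] (H →L[ℂ] H)}
    {s : ℝ} {r w e : H →L[ℂ] H} (hs : 0 < s) (hr : IsStarProjection r) (hwM : w ∈ M)
    (htN : ∀ x, t x ∈ N) (htr : ∀ x, t x * r = t x)
    (htw : ∀ x, t x * w = w * (x : H →L[ℂ] H))
    (he : IsCondExpOn φ (N : Set (H →L[ℂ] H)) (w * star w) e) (hle : (s : ℂ) • r ≤ e)
    {U : Filter ℕ} [U.NeBot] {y : ℕ → A.toNonUnitalStarSubalgebra}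
    {a : A.toNonUnitalStarSubalgebra} {b : H →L[ℂ] H}
    (hy : WeakLim U (fun n => (y n : H →L[ℂ] H)) a) (hty : WeakLim U (fun n => t (y n)) b) :
    b = t a := by
  have hbN : b ∈ N := (VNSubalgebra.ofVonNeumannAlgebra N).weakLim_mem hty fun n => htN (y n)
  have hbr : b * r = b := by
    refine (hty.mul_right r).unique ?_
    simpa only [htr] using hty
  -- Both sides are the weak limit of t(yₙ)w = wyₙ. Agreement on w implies agreement on r.
  have hbw : b * w = t a * w := by
    rw [htw]
    refine (hty.mul_right w).unique ?_
    simpa only [htw] using hy.mul_left w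
  have h1 := IsCondExpOn.mul_eq_zero hφ hNM hs hr (mul_mem hwM (star_mem hwM)) he (Or.inr hle)
    (sub_mem hbN (htN a)) (by rw [← mul_assoc, sub_mul, hbw, sub_self, zero_mul])
  rwa [sub_mul, hbr, htr, sub_eq_zero] at h1

end Intertwiner

/-! ### Transfer of orthogonality and of finite index. -/

section FiniteIndex

variable {H : Type*} [NormedAddCommGroup H] [InnerProductSpace ℂ H] [CompleteSpace H]
  {M N : VonNeumannAlgebra H} {φ : (H →L[ℂ] H) →ₗ[ℂ] ℂ}

/-- The linear span of the products of two commuting `*`-algebras is a `*`-algebra. -/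
theorem exists_starSubalgebra_eq_span_mul (A B : NonUnitalStarSubalgebra ℂ (H →L[ℂ] H))
    (hAB : ∀ a ∈ A, ∀ b ∈ B, a * b = b * a) :
    ∃ S : NonUnitalStarSubalgebra ℂ (H →L[ℂ] H), ∀ x, x ∈ S ↔
      x ∈ Submodule.span ℂ {x : H →L[ℂ] H | ∃ a ∈ A, ∃ b ∈ B, x = a * b} := by
  set G := {x : H →L[ℂ] H | ∃ a ∈ A, ∃ b ∈ B, x = a * b} with hG
  let V := Submodule.span ℂ G
  have hmul : ∀ x ∈ V, ∀ y ∈ V, x * y ∈ V := by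
    intro x hx y hy
    have h1 : x * y ∈ V * V := Submodule.mul_mem_mul hx hy
    rw [Submodule.span_mul_span] at h1
    refine Submodule.span_mono ?_ h1
    rintro _ ⟨_, ⟨a, ha, b, hb, rfl⟩, _, ⟨a', ha', b', hb', rfl⟩, rfl⟩
    refine ⟨a * a', mul_mem ha ha', b * b', mul_mem hb hb', ?_⟩
    show a * b * (a' * b') = _
    rw [mul_assoc a b, ← mul_assoc b a', ← hAB a' ha' b hb]
    simp only [mul_assoc]
  have hstar : ∀ x ∈ V, star x ∈ V := by
    intro x hx
    induction hx using Submodule.span_induction with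
    | mem x h =>
      obtain ⟨a, ha, b, hb, rfl⟩ := h
      refine Submodule.subset_span ⟨star a, star_mem ha, star b, star_mem hb, ?_⟩
      rw [star_mul, hAB _ (star_mem ha) _ (star_mem hb)]
    | zero => rw [star_zero]; exact zero_mem V
    | add x y _ _ hx hy => rw [star_add]; exact add_mem hx hy
    | smul c x _ hx => rw [star_smul]; exact V.smul_mem _ hx
  exact ⟨{ carrier := V
           add_mem' := fun h h' => add_mem h h'
           zero_mem' := zero_mem V
           mul_mem' := fun {a b} h h' => hmul a h b h'
           smul_mem' := fun c x h => V.smul_mem c h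
           star_mem' := fun {a} h => hstar a h }, fun x => Iff.rfl⟩

/-- The expectations of `w y w*`, for `y` in the relative commutant, commute with the image of an
intertwiner. -/
theorem condExp_commute_of_intertwines (hφ : IsTraceOn M φ) (hNM : ∀ y ∈ N, y ∈ M)
    {A : VNSubalgebra H} {t : A.toNonUnitalStarSubalgebra →⋆ₙₐ[ℂ] (H →L[ℂ] H)}
    {w y g : H →L[ℂ] H} (hwM : w ∈ M) (hyM : y ∈ M) (htN : ∀ x, t x ∈ N)
    (htw : ∀ x, t x * w = w * (x : H →L[ℂ] H))
    (hy : ∀ x ∈ A.toSet, x * y = y * x)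
    (hg : IsCondExpOn φ (N : Set (H →L[ℂ] H)) (w * y * star w) g) (x) : t x * g = g * t x := by
  let S := (VNSubalgebra.ofVonNeumannAlgebra N).toNonUnitalStarSubalgebra
  have hM : w * y * star w ∈ M := mul_mem (mul_mem hwM hyM) (star_mem hwM)
  have h1 := IsCondExpOn.mul_left (S := S) hφ hNM hg hM (htN x)
  have h2 := IsCondExpOn.mul_right (S := S) hg (htN x)
  have h3 : star w * t x = (x : H →L[ℂ] H) * star w := by
    have := congrArg star (htw (star x))
    rw [star_mul, star_mul, ← map_star, star_star] at this
    simpa using this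
  -- wyw* already commutes with t(x); bimodularity passes this to its expectation.
  have h4 : t x * (w * y * star w) = w * y * star w * t x := by
    rw [← mul_assoc, ← mul_assoc, htw, mul_assoc w, hy x x.2, mul_assoc _ _ (t x), h3]
    simp only [mul_assoc]
  rw [h4] at h1
  exact IsCondExpOn.unique (S := S) hφ hNM h1 h2

/-- Such an expectation lies in the corner of the unit of the intertwiner. -/
theorem condExp_mem_corner_of_intertwines (hφ : IsTraceOn M φ) (hNM : ∀ y ∈ N, y ∈ M)
    {r w y g : H →L[ℂ] H} (hr : IsStarProjection r) (hrN : r ∈ N) (hwM : w ∈ M) (hyM : y ∈ M)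
    (hrw : r * w = w) (hg : IsCondExpOn φ (N : Set (H →L[ℂ] H)) (w * y * star w) g) :
    g ∈ N ∧ r * g = g ∧ g * r = g := by
  let S := (VNSubalgebra.ofVonNeumannAlgebra N).toNonUnitalStarSubalgebra
  have hM : w * y * star w ∈ M := mul_mem (mul_mem hwM hyM) (star_mem hwM)
  have h1 := IsCondExpOn.mul_left (S := S) hφ hNM hg hM hrN
  have h2 := IsCondExpOn.mul_right (S := S) hg hrN
  have h3 : star w * r = star w := by
    have := congrArg star hrw
    rwa [star_mul, hr.isSelfAdjoint.star_eq] at this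
  have h4 : r * (w * y * star w) = w * y * star w := by
    rw [← mul_assoc, ← mul_assoc, hrw]
  have h5 : w * y * star w * r = w * y * star w := by rw [mul_assoc, h3]
  rw [h4] at h1
  rw [h5] at h2
  exact ⟨hg.1, IsCondExpOn.unique (S := S) hφ hNM h1 hg,
    IsCondExpOn.unique (S := S) hφ hNM h2 hg⟩

/-- Operators of `N` orthogonal to `P₀ ∨ (P₀' ∩ r N r)` are moved by an intertwiner to operators
orthogonal to `P ∨ (P' ∩ z M z)`. -/
theorem map_mul_conjugate_eq_zero (hφ : IsTraceOn M φ) (hNM : ∀ y ∈ N, y ∈ M)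
    {P R : VNSubalgebra H} (hPM : ∀ y ∈ P.toSet, y ∈ M) (hRM : ∀ y ∈ R.toSet, y ∈ M)
    (hPR : ∀ a ∈ P.toSet, ∀ b ∈ R.toSet, a * b = b * a) (hu : P.unit = R.unit)
    {c : H →L[ℂ] H} (hc : IsStarProjection c) (hcP : c ∈ P.toSet)
    {t : (P.corner c hc hcP).toNonUnitalStarSubalgebra →⋆ₙₐ[ℂ] (H →L[ℂ] H)}
    {w d : H →L[ℂ] H} (hwM : w ∈ M) (hwc : w * c = w) (htN : ∀ x, t x ∈ N)
    (htw : ∀ x, t x * w = w * (x : H →L[ℂ] H)) (hdN : d ∈ N)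
    (hd : ∀ x b g, b ∈ R.toSet → IsCondExpOn φ (N : Set (H →L[ℂ] H)) (w * b * star w) g →
      φ (d * (t x * g)) = 0)
    {a : H →L[ℂ] H} (ha : a ∈ Set.centralizer (Set.centralizer (P.toSet ∪ R.toSet)))
    (hau : a * P.unit = a) : φ (a * (star w * d * w)) = 0 := by
  let S := (VNSubalgebra.ofVonNeumannAlgebra N).toNonUnitalStarSubalgebra
  have hws := star_mem (s := M) hwM
  have hdM := hNM d hdN
  obtain ⟨A, hA⟩ := exists_starSubalgebra_eq_span_mul P.toNonUnitalStarSubalgebra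
    R.toNonUnitalStarSubalgebra hPR
  have hPA : P.toSet ⊆ (A : Set (H →L[ℂ] H)) := fun x hx => (hA x).2
    (Submodule.subset_span ⟨x, hx, R.unit, R.unit_mem, by rw [← hu, P.mul_unit x hx]⟩)
  have hRA : R.toSet ⊆ (A : Set (H →L[ℂ] H)) := fun x hx => (hA x).2
    (Submodule.subset_span ⟨P.unit, P.unit_mem, x, hx, by rw [hu, R.unit_mul x hx]⟩)
  have hgen : ∀ a ∈ P.toSet, ∀ b ∈ R.toSet, φ (a * b * (star w * d * w)) = 0 := by
    intro a ha b hb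
    have haM := hPM a ha
    have hbM := hRM b hb
    have hwbM : w * b * star w ∈ M := mul_mem (mul_mem hwM hbM) hws
    -- a is not in the domain of t, but w = wc and b commutes with c, so compressing a to cac leaves
    -- wabw* unchanged.
    let x : (P.corner c hc hcP).toNonUnitalStarSubalgebra :=
      ⟨c * a * c, P.mul_mem' (P.mul_mem' hcP ha) hcP,
        by rw [← mul_assoc, ← mul_assoc, hc.isIdempotentElem.eq],
        by rw [mul_assoc, hc.isIdempotentElem.eq]⟩
    obtain ⟨⟨g, hg⟩, -⟩ := (VNSubalgebra.ofVonNeumannAlgebra N).exists_isCondExpOn hφ hNM hwbM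
    have h1 := IsCondExpOn.mul_left (S := S) hφ hNM hg hwbM (htN x)
    have h2 := h1.2 d hdN
    have hcw : c * star w = star w := by
      have := congrArg star hwc
      rwa [star_mul, hc.isSelfAdjoint.star_eq] at this
    have h3 : t x * (w * b * star w) = w * (a * b) * star w := by
      calc t x * (w * b * star w) = w * (c * a * c) * b * star w := by
            rw [← mul_assoc, ← mul_assoc, htw]
        _ = (w * c) * a * (c * b) * star w := by simp only [mul_assoc]
        _ = w * (a * b) * (c * star w) := by rw [hwc, hPR c hcP b hb]; simp only [mul_assoc]
        _ = _ := by rw [hcw]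
    have hgM := hNM g hg.1
    have htM := hNM _ (htN x)
    rw [h3, hφ.trace _ (mul_mem htM hgM) _ hdM, hd x b g hb hg] at h2
    rw [← mul_assoc, ← mul_assoc, hφ.trace _ (mul_mem (mul_mem (mul_mem haM hbM) hws) hdM) _ hwM]
    rw [h2]
    simp only [mul_assoc]
  -- Products ab span a *-algebra whose bicommutant contains that of P ∪ R, so density extends the
  -- vanishing from products to `a`.
  have h0 := (hφ.normal.compress 1 (star w * d * w)).eq_zero_of_mem_bicommutant A
    (e := P.unit) (hPA P.unit_mem) (fun y hy => by
      show φ (1 * y * (star w * d * w)) = 0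
      rw [one_mul]
      have hy' := (hA y).1 hy
      induction hy' using Submodule.span_induction with
      | mem x h =>
        obtain ⟨a, ha, b, hb, rfl⟩ := h
        exact hgen a ha b hb
      | zero => rw [zero_mul, map_zero]
      | add x y hx' hy' ihx ihy =>
        rw [add_mul, map_add, ihx ((hA _).2 hx'), ihy ((hA _).2 hy'), add_zero]
      | smul k x hx' ih =>
        rw [smul_mul_assoc, map_smul, ih ((hA _).2 hx'), smul_zero])
    (Set.centralizer_subset (Set.centralizer_subset (Set.union_subset hPA hRA)) ha) hau
  have h1 : φ (1 * a * (star w * d * w)) = 0 := h0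
  rwa [one_mul] at h1

variable {τ : M.toStarSubalgebra →ₗ[ℂ] ℂ}

/-- Finiteness of the index passes along a compression that is bounded below in the `2`-norm and
that does not increase the norms of expectations. -/
theorem ppIndex_lt_top_of_compress (heq : ∀ x : M.toStarSubalgebra, φ (x : H →L[ℂ] H) = τ x)
    (hφ : IsTraceOn M φ) {A A' : Set (H →L[ℂ] H)} (B B' : VNSubalgebra H)
    (hBM : ∀ y ∈ B.toSet, y ∈ M) (hB'M : ∀ y ∈ B'.toSet, y ∈ M)
    {s : ℝ} (hs : 0 < s) {w : H →L[ℂ] H} (hwM : w ∈ M)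
    (hA : ∀ x ∈ M, x ∈ A' → star w * x * w ∈ A)
    (hge : ∀ x ∈ M, x ∈ A' → 0 ≤ x → s ^ 2 * sqNormTwo φ x ≤ sqNormTwo φ (star w * x * w))
    (hle : ∀ x ∈ M, x ∈ A' → ∀ e b, IsCondExpOn φ B.toSet (star w * x * w) e →
      IsCondExpOn φ B'.toSet x b → sqNormTwo φ e ≤ sqNormTwo φ b)
    (hidx : ppIndex τ A B.toSet < ⊤) : ppIndex τ A' B'.toSet < ⊤ := by
  rw [ppIndex, ENNReal.inv_lt_top] at hidx ⊢
  have hs2 : 0 < ENNReal.ofReal (s ^ 2) := ENNReal.ofReal_pos.2 (by positivity)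
  -- If λ is the infimum for the source inclusion, every quotient of the target is at least s²λ.
  refine (ENNReal.mul_pos hs2.ne' hidx.ne').trans_le ?_
  refine le_iInf₂ fun x hx => ?_
  obtain ⟨hxA, hx0, hxne⟩ := hx
  have hxM : (x : H →L[ℂ] H) ∈ M := x.2
  have hyM : star w * x * w ∈ M := mul_mem (mul_mem (star_mem hwM) hxM) hwM
  have hge' := hge x hxM hxA hx0
  have hnx : 0 < sqNormTwo φ (x : H →L[ℂ] H) :=
    (hφ.sqNormTwo_nonneg hxM).lt_of_ne fun h0 => hxne
      (Subtype.ext (hφ.eq_zero_of_sqNormTwo_eq_zero hxM h0.symm))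
  have hny : 0 < sqNormTwo φ (star w * x * w) :=
    (mul_pos (pow_pos hs 2) hnx).trans_le hge'
  let y : M.toStarSubalgebra := ⟨star w * x * w, hyM⟩
  have hy : (y : H →L[ℂ] H) ∈ A ∧ 0 ≤ (y : H →L[ℂ] H) ∧ y ≠ 0 := by
    refine ⟨hA x hxM hxA, star_left_conjugate_nonneg hx0 w, fun h0 => ?_⟩
    have h1 : star w * x * w = 0 := congrArg Subtype.val h0
    rw [h1] at hny
    simp [sqNormTwo] at hny
  obtain ⟨⟨e, he⟩, -⟩ := B.exists_isCondExpOn hφ hBM hyM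
  obtain ⟨⟨b, hb⟩, -⟩ := B'.exists_isCondExpOn hφ hB'M hxM
  have hce : (condExp τ B.toSet y : H →L[ℂ] H) = e :=
    coe_condExp_eq heq hφ B.toNonUnitalStarSubalgebra hBM y he
  have hcb : (condExp τ B'.toSet x : H →L[ℂ] H) = b :=
    coe_condExp_eq heq hφ B'.toNonUnitalStarSubalgebra hB'M x hb
  have hle' := hle x hxM hxA e b he hb
  refine (mul_le_mul_right (iInf₂_le y hy) _).trans ?_
  rw [← ENNReal.ofReal_mul (by positivity)]
  refine ENNReal.ofReal_le_ofReal ?_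
  rw [traceNorm_sq heq hφ, traceNorm_sq heq hφ, traceNorm_sq heq hφ, traceNorm_sq heq hφ, hce, hcb]
  show s ^ 2 * (sqNormTwo φ e / sqNormTwo φ (star w * x * w)) ≤ _
  rw [mul_div_assoc', div_le_div_iff₀ hny hnx]
  have hne := hφ.sqNormTwo_nonneg (hBM e he.1)
  calc s ^ 2 * sqNormTwo φ e * sqNormTwo φ (x : H →L[ℂ] H)
      = sqNormTwo φ e * (s ^ 2 * sqNormTwo φ (x : H →L[ℂ] H)) := by ring
    _ ≤ sqNormTwo φ b * sqNormTwo φ (star w * x * w) :=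
      mul_le_mul hle' hge' (by positivity) (hne.trans hle')

end FiniteIndex

/-! ### The proposition. -/

theorem mainTheorem9 {H : Type*} [NormedAddCommGroup H] [InnerProductSpace ℂ H] [CompleteSpace H]
    (M : VonNeumannAlgebra H) (τ : M.toStarSubalgebra →ₗ[ℂ] ℂ)
    (hτ : IsFaithfulNormalTracialState M τ)
    (z : H →L[ℂ] H) (hz : IsStarProjection z)
    (hzM : z ∈ (VNSubalgebra.ofVonNeumannAlgebra M).toSet) (hz0 : z ≠ 0)
    (P : VNSubalgebra H) (hPz : P.unit = z)
    (hPM : P.toSet ⊆ ((VNSubalgebra.ofVonNeumannAlgebra M).corner z hz hzM).toSet)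
    (N : VonNeumannAlgebra H) (hNM : N ≤ M)
    (hindex : ppIndex τ ((VNSubalgebra.ofVonNeumannAlgebra M).corner z hz hzM).toSet
      (vnGenerated (P.toSet ∪ relCommutant P.toSet
        ((VNSubalgebra.ofVonNeumannAlgebra M).corner z hz hzM).toSet)) < ⊤)
    (hPN : CornerEmbeds M P (VNSubalgebra.ofVonNeumannAlgebra N)) :
    ∃ (s : ℝ) (r : H →L[ℂ] H) (hr : IsStarProjection r)
      (hrN : r ∈ (VNSubalgebra.ofVonNeumannAlgebra N).toSet)
      (p : H →L[ℂ] H) (hp : IsStarProjection p) (hpP : p ∈ P.toSet)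
      (P₀ : VNSubalgebra H)
      (θ : (P.corner p hp hpP).toNonUnitalStarSubalgebra ≃⋆ₐ[ℂ] P₀.toNonUnitalStarSubalgebra),
      0 < s ∧ r ≠ 0 ∧ p ≠ 0 ∧ P₀.unit = r ∧
      P₀.toSet ⊆ ((VNSubalgebra.ofVonNeumannAlgebra N).corner r hr hrN).toSet ∧
      ppIndex τ ((VNSubalgebra.ofVonNeumannAlgebra N).corner r hr hrN).toSet
        (vnGenerated (P₀.toSet ∪ relCommutant P₀.toSet
          ((VNSubalgebra.ofVonNeumannAlgebra N).corner r hr hrN).toSet)) < ⊤ ∧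
      ∃ v : M.toStarSubalgebra,
        v ≠ 0 ∧ IsPartialIsometry (v : H →L[ℂ] H) ∧
        r * (condExp τ N (v * star v) : H →L[ℂ] H) = (condExp τ N (v * star v) : H →L[ℂ] H) * r ∧
        (s : ℂ) • r ≤ r * (condExp τ N (v * star v) : H →L[ℂ] H) ∧
        (∀ x, (θ x : H →L[ℂ] H) * v = r * v * (x : H →L[ℂ] H)) ∧
        Set.range (fun x => (θ x : H →L[ℂ] H) * v) = (fun a => a * (v : H →L[ℂ] H)) '' P₀.toSet ∧
        (fun a => a * (v : H →L[ℂ] H)) '' P₀.toSet =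
          (fun x => r * v * x) '' (P.corner p hp hpP).toSet ∧
        vnGenerated {w | ∃ y : M.toStarSubalgebra,
            (y : H →L[ℂ] H) ∈ (fun t => p * t * p) '' Set.centralizer P.toSet ∧
            p * (y : H →L[ℂ] H) = y ∧ (y : H →L[ℂ] H) * p = y ∧
            w = (condExp τ N (v * y * star v) : H →L[ℂ] H)} ⊆
          relCommutant P₀.toSet ((VNSubalgebra.ofVonNeumannAlgebra N).corner r hr hrN).toSet := by
  obtain ⟨φ, hφ, heq⟩ := hτ.exists_isTraceOn
  have hNM' : ∀ y ∈ N, y ∈ M := fun y hy => hNM hy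
  have hPM' : ∀ y ∈ P.toSet, y ∈ M := fun y hy => (hPM hy).1
  obtain ⟨s, r, w, e, c, hc, hcP, t, hs, hr, hrN, hr0, hc0, hwM, hwpi, hrw, hwc, htN, htc, hinj,
    htw, he, hle⟩ := hPN.exists_intertwiner hφ hNM'
  have hrr := hr.isIdempotentElem.eq
  have hws := star_mem (s := M) hwM
  have hwwM : w * star w ∈ M := mul_mem hwM hws
  let A := P.corner c hc hcP
  let c' : A.toNonUnitalStarSubalgebra := ⟨c, A.unit_mem⟩
  have htr : ∀ x, t x * r = t x := fun x => by
    rw [← htc, ← map_mul]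
    exact congrArg t (Subtype.ext (A.mul_unit x x.2))
  have hrt : ∀ x, r * t x = t x := fun x => by
    rw [← htc, ← map_mul]
    exact congrArg t (Subtype.ext (A.unit_mul x x.2))
  obtain ⟨P₀, hP₀, hP₀u⟩ := exists_vnSubalgebra_eq_range hφ A t (fun x => hNM' _ (htN x)) hinj
    (fun U y a b _ hy hty => eq_of_weakLim_of_intertwines hφ hNM' hs hr hwM htN htr htw he hle
      hy hty)
  have htP₀ : ∀ x, t x ∈ P₀.toNonUnitalStarSubalgebra := fun x => by
    show t x ∈ P₀.toSet
    rw [hP₀]; exact ⟨x, rfl⟩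
  replace hP₀u : P₀.unit = r := hP₀u.trans htc
  let θ₀ : A.toNonUnitalStarSubalgebra →⋆ₙₐ[ℂ] P₀.toNonUnitalStarSubalgebra :=
    NonUnitalStarAlgHom.codRestrict t P₀.toNonUnitalStarSubalgebra htP₀
  have hθ₀ : ∀ x, (θ₀ x : H →L[ℂ] H) = t x := fun x => rfl
  have hbij : Function.Bijective θ₀ := by
    refine ⟨fun x y hxy => hinj (congrArg Subtype.val hxy), fun y => ?_⟩
    have hy : (y : H →L[ℂ] H) ∈ P₀.toSet := y.2
    rw [hP₀] at hy
    obtain ⟨x, hx⟩ := hy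
    exact ⟨x, Subtype.ext hx⟩
  let θ := StarAlgEquiv.ofBijective θ₀ hbij
  have hθ : ∀ x, (θ x : H →L[ℂ] H) = t x := fun x => rfl
  let NV := VNSubalgebra.ofVonNeumannAlgebra N
  let C := NV.corner r hr hrN
  have hP₀C : P₀.toSet ⊆ C.toSet := by
    rw [hP₀]
    rintro _ ⟨x, rfl⟩
    exact ⟨htN x, hrt x, htr x⟩
  obtain ⟨R₀, hR₀, hR₀u⟩ := exists_vnSubalgebra_eq_relCommutant P₀ C hP₀u
  -- Used twice: for elements of P' ∩ zMz in the index estimate, and for elements of cP'c in the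
  -- last assertion.
  have hgR : ∀ y ∈ M, (∀ x ∈ A.toSet, x * y = y * x) → ∀ g,
      IsCondExpOn φ (N : Set (H →L[ℂ] H)) (w * y * star w) g →
      g ∈ relCommutant P₀.toSet C.toSet := by
    intro y hy hcomm g hg
    refine ⟨?_, condExp_mem_corner_of_intertwines hφ hNM' hr hrN hwM hy hrw hg⟩
    rw [hP₀]
    rintro _ ⟨x, rfl⟩
    exact condExp_commute_of_intertwines hφ hNM' hwM hy htN htw hcomm hg x
  have hvw : ∀ x, t x * w = r * w * (x : H →L[ℂ] H) := fun x => by rw [htw, hrw]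
  let w' : M.toStarSubalgebra := ⟨w, hwM⟩
  have hE : (condExp τ N (w' * star w') : H →L[ℂ] H) = e :=
    coe_condExp_eq heq hφ NV.toNonUnitalStarSubalgebra hNM' (w' * star w') he
  have heC := condExp_mem_corner_of_intertwines hφ hNM' hr hrN hwM (one_mem M) hrw
    (by rwa [mul_one] : IsCondExpOn φ (N : Set (H →L[ℂ] H)) (w * 1 * star w) e)
  refine ⟨s, r, hr, hrN, c, hc, hcP, P₀, θ, hs, hr0, hc0, hP₀u, hP₀C, ?_, w', ?_, hwpi, ?_, ?_,
    ?_, ?_, ?_, ?_⟩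
  · let MV := VNSubalgebra.ofVonNeumannAlgebra M
    let Z := MV.corner z hz hzM
    obtain ⟨R, hR, hRu⟩ := exists_vnSubalgebra_eq_relCommutant P Z hPz
    have hRM : ∀ y ∈ R.toSet, y ∈ M := fun y hy => by rw [hR] at hy; exact hy.2.1
    have hRcomm : ∀ a ∈ P.toSet, ∀ b ∈ R.toSet, a * b = b * a := fun a ha b hb => by
      rw [hR] at hb; exact hb.1 a ha
    have hzunit : P.unit = R.unit := hPz.trans hRu.symm
    have hPmul : ∀ x ∈ P.toSet ∪ R.toSet, P.unit * x = x ∧ x * P.unit = x := by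
      rintro x (hx | hx)
      · exact ⟨P.unit_mul x hx, P.mul_unit x hx⟩
      · rw [hzunit]; exact ⟨R.unit_mul x hx, R.mul_unit x hx⟩
    obtain ⟨Q, hQ, hQu, hQc⟩ := exists_vnSubalgebra_eq_vnGenerated (S := P.toSet ∪ R.toSet)
      (fun x hx => hx.imp (fun h => P.star_mem' h) (fun h => R.star_mem' h)) (Or.inl P.unit_mem)
      (fun x hx => (hPmul x hx).1) (fun x hx => (hPmul x hx).2)
    have hP₀mul : ∀ x ∈ P₀.toSet ∪ R₀.toSet, r * x = x ∧ x * r = x := by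
      rintro x (hx | hx)
      · rw [← hP₀u]; exact ⟨P₀.unit_mul x hx, P₀.mul_unit x hx⟩
      · rw [hR₀] at hx; exact hx.2.2
    obtain ⟨B, hB, hBu, -⟩ := exists_vnSubalgebra_eq_vnGenerated (S := P₀.toSet ∪ R₀.toSet)
      (fun x hx => hx.imp (fun h => P₀.star_mem' h) (fun h => R₀.star_mem' h))
      (Or.inl (hP₀u ▸ P₀.unit_mem))
      (fun x hx => (hP₀mul x hx).1) (fun x hx => (hP₀mul x hx).2)
    have hQM : ∀ y ∈ Q.toSet, y ∈ M := fun y hy => by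
      rw [hQ] at hy
      exact (hy Z (Set.union_subset hPM (hR ▸ Set.inter_subset_right))).1
    have hBC : B.toSet ⊆ C.toSet := fun y hy => by
      rw [hB] at hy
      exact hy C (Set.union_subset hP₀C (hR₀ ▸ Set.inter_subset_right))
    have hBM : ∀ y ∈ B.toSet, y ∈ M := fun y hy => hNM' y (hBC hy).1
    have hww1 : w * star w ≤ 1 := by
      have : IsStarProjection (w * star w) :=
        ⟨by rw [IsIdempotentElem, ← mul_assoc, hwpi], IsSelfAdjoint.mul_star_self w⟩
      exact this.le_one
    have hzc : z * c = c := (hPM hcP).2.1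
    have hcz : c * z = c := (hPM hcP).2.2
    have hwz : w * z = w := by rw [← hwc, mul_assoc, hcz]
    have hzw : z * star w = star w := by
      have := congrArg star hwz
      rwa [star_mul, hz.isSelfAdjoint.star_eq] at this
    rw [← hR, ← hQ] at hindex
    rw [← hR₀, ← hB]
    refine ppIndex_lt_top_of_compress (A := Z.toSet) (A' := C.toSet) heq hφ Q B hQM hBM hs
      hwM
      (fun x hx _ => ⟨mul_mem (mul_mem hws hx) hwM, by rw [← mul_assoc, ← mul_assoc, hzw],
        by rw [mul_assoc, hwz]⟩)
      (fun x hx hxC hx0 => hφ.sqNormTwo_conjugate_ge hs.le hNM' hwM he (hNM' r hrN) hle hx hx0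
        (mul_mem hxC.1 hxC.1) hxC.2.1) ?_ hindex
    intro x hx hxC f b hf hb
    refine hφ.sqNormTwo_condExp_le (Q := Q.toNonUnitalStarSubalgebra) hQM hwM hww1 hx
      (hBM b hb.1) hf fun a ha => ?_
    have hau : a * P.unit = a := by rw [← hQu]; exact Q.mul_unit a ha
    refine map_mul_conjugate_eq_zero hφ hNM' hPM' hRM hRcomm hzunit hc hcP hwM hwc htN htw
      (sub_mem hxC.1 (hBC hb.1).1) ?_ (hQc ha) hau
    intro y k g hk hg
    -- E_N(wkw*) lies in P₀' ∩ rNr, so t(y)g lies in B, to which x − E_B(x) is orthogonal.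
    have hgR₀ : g ∈ R₀.toSet := by
      rw [hR₀]
      exact hgR k (hRM k hk) (fun x hx => hRcomm x hx.1 k hk) g hg
    have hmem : ∀ u ∈ P₀.toSet ∪ R₀.toSet, u ∈ B.toSet := fun u hu => by
      rw [hB]; exact fun A hA => hA hu
    have htg : t y * g ∈ B.toSet := B.mul_mem' (hmem _ (Or.inl (htP₀ y))) (hmem _ (Or.inr hgR₀))
    rw [sub_mul, map_sub, hb.2 _ htg, sub_self]
  · intro h0
    have hw0 : w = 0 := congrArg Subtype.val h0
    have h1 : r * r = 0 := IsCondExpOn.mul_eq_zero hφ hNM' hs hr hwwM he (Or.inr hle) hrN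
      (by rw [hw0, zero_mul, mul_zero])
    exact hr0 (hrr ▸ h1)
  · rw [hE, heC.2.1, heC.2.2]
  · rw [hE, heC.2.1]; exact hle
  · exact hvw
  · ext x
    constructor
    · rintro ⟨y, rfl⟩
      exact ⟨_, (θ y).2, rfl⟩
    · rintro ⟨y, hy, rfl⟩
      rw [hP₀] at hy
      obtain ⟨x, rfl⟩ := hy
      exact ⟨x, rfl⟩
  · ext x
    constructor
    · rintro ⟨y, hy, rfl⟩
      rw [hP₀] at hy
      obtain ⟨x, rfl⟩ := hy
      exact ⟨x, x.2, (hvw x).symm⟩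
    · rintro ⟨y, hy, rfl⟩
      exact ⟨_, htP₀ ⟨y, hy⟩, hvw ⟨y, hy⟩⟩
  · intro x hx
    have h1 := hx R₀ ?_
    · rwa [hR₀] at h1
    · rintro _ ⟨y, ⟨k, hk, hky⟩, -, -, rfl⟩
      have hyM : (y : H →L[ℂ] H) ∈ M := y.2
      -- y = ckc with k in P', and for x in cPc both products reduce to kx.
      have hcomm : ∀ x ∈ A.toSet, x * (y : H →L[ℂ] H) = y * x := by
        intro x hx
        have hky' : c * k * c = y := hky
        rw [← hky', ← mul_assoc, ← mul_assoc, hx.2.2, mul_assoc _ c x, hx.2.1, hk x hx.1,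
          mul_assoc k, hx.2.2, hk c hcP, mul_assoc k, hx.2.1]
      obtain ⟨⟨g, hg⟩, -⟩ := NV.exists_isCondExpOn hφ hNM'
        (mul_mem (mul_mem hwM hyM) hws)
      have hcg : (condExp τ N (w' * y * star w') : H →L[ℂ] H) = g :=
        coe_condExp_eq heq hφ NV.toNonUnitalStarSubalgebra hNM' (w' * y * star w') hg
      rw [hR₀, hcg]
      exact hgR y hyM hcomm g hg
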